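/- Let $\epsilon\in\{-1,1\}$. An \emph{$\epsilon$-Kähler manifold} $(M,J,g)$ is a pseudo-Riemannian manifold $(M,g)$ of dimension $2n$ with a $g$-skew-symmetric endomorphism field $J$ such that $J^2=\epsilon\,\mathrm{Id}$ and $DJ=0$, where $D$ is the Levi-Civita connection of $g$; its Kähler form is $\omega=\epsilon g(J\cdot,\cdot)$. It is \emph{affine special} if it is endowed with a flat torsion-free connection $\nabla$ such that $\nabla\omega=0$ and $(\nabla_XJ)Y=(\nabla_YJ)X$ for all vector fields $X,Y$. It is \emph{conical} if it is moreover endowed with a vector field $\xi$ such that $\nabla\xi=D\xi=\mathrm{Id}$. Let $\mathbb{C}_\epsilon=\mathbb{R}[i_\epsilon]$, $i_\epsilon^2=\epsilon$, and let $V=\mathbb{C}_\epsilon^{2n}$ with coordinates $(z^i,w_i)$, the form $\Omega=\sum dz^i\wedge dw_i$ and the sesquilinear form $\gamma=i_\epsilon\,\Omega(\cdot,\overline{\,\cdot\,})$. Local coordinates $(q^a)_{a=1,\dots,2n}=(x^i,y_i)$ on an open set $U\subset M$ are \emph{special affine coordinates} if $\nabla\frac{\partial}{\partial q^a}=0$ on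 $U$ for all $a$ and there is an immersion $\phi:U\to V$ with $d\phi\circ J=i_\epsilon\,d\phi$ (holomorphic), $\phi^*\Omega=0$ (Lagrangian), $\phi^*\gamma$ non-degenerate ($\epsilon$-Kählerian) and $g=\mathrm{Re}\,\phi^*\gamma$, such that $x^i=\mathrm{Re}(z^i\circ\phi)$ and $y_i=\mathrm{Re}(w_i\circ\phi)$. They are \emph{conical} if in addition $$\xi=\sum_a q^a\frac{\partial}{\partial q^a}=\sum_i x^i\frac{\partial}{\partial x^i}+\sum_i y_i\frac{\partial}{\partial y_i}\quad\text{on } U.$$ \textbf{Proposition.} Let $(M,J,g,\nabla,\xi)$ be a conical affine special $\epsilon$-Kähler manifold of dimension $2n$. Then every point of $M$ has a connected open neighborhood on which there exist conical special affine coordinates. These coordinates are unique up to a linear symplectic transformation: if $q$ and $q'$ are conical special affine coordinates on $U$ and $U'$, then for every connected open $W\subset U\cap U'$ there is $A\in\mathrm{Sp}(2n,\mathbb{R})$ with $q'=Aq$ on $W$; and conversely, if $q$ are conical special affine coordinates on $U$ and $A\in\mathrm{Sp}(2n,\mathbb{R})$, then $Aq$ are conical special affine coordinates on $U$. -/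

import Mathlib

open Set
open scoped Manifold ContDiff

namespace SpecialGeometry

noncomputable section

/-! ### The ring of `ε`-complex numbers and the model space `V = ℂ_ε^{2n}` -/

/-- The ring of `ε`-complex numbers `ℂ_ε = ℝ[i_ε]`, `i_ε ^ 2 = ε`.
`star` is the `ε`-complex conjugation `a + i_ε b ↦ a - i_ε b`. -/
abbrev EpsComplex (ε : ℝ) : Type := QuadraticAlgebra ℝ ε 0

/-- The unit `i_ε`. -/
def epsI (ε : ℝ) : EpsComplex ε := ⟨0, 1⟩

/-- The space `V = ℂ_ε^{2n}`. The coordinates `z^i` have index `Sum.inl i`, the coordinates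
`w_i` have index `Sum.inr i`. -/
abbrev EpsV (ε : ℝ) (n : ℕ) : Type := Fin n ⊕ Fin n → EpsComplex ε

/-- The standard holomorphic symplectic form `Ω = ∑ dz^i ∧ dw_i` on `V`. -/
def stdOmega {ε : ℝ} {n : ℕ} (a b : EpsV ε n) : EpsComplex ε :=
  ∑ i : Fin n, (a (Sum.inl i) * b (Sum.inr i) - a (Sum.inr i) * b (Sum.inl i))

/-- The Hermitian-symmetric sesquilinear form `γ = i_ε Ω(·, τ ·)` on `V`, where `τ` is the
componentwise conjugation. -/
def stdGamma {ε : ℝ} {n : ℕ} (a b : EpsV ε n) : EpsComplex ε :=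
  epsI ε * stdOmega a (star b)

/-! ### Tensor fields and connections on a `2n`-dimensional manifold -/

section Manifold

variable {n : ℕ} {M : Type*} [TopologicalSpace M]
  [ChartedSpace (EuclideanSpace ℝ (Fin (2 * n))) M]

variable (n M) in
/-- Vector fields on `M`, not necessarily continuous. -/
abbrev VField : Type _ := Π x : M, TangentSpace (𝓡 (2 * n)) x

variable (n M) in
/-- Fields of bilinear forms on the tangent spaces of `M`, not necessarily continuous. -/
abbrev BilinField : Type _ :=
  Π x : M, TangentSpace (𝓡 (2 * n)) x →L[ℝ] TangentSpace (𝓡 (2 * n)) x →L[ℝ] ℝ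

variable (n M) in
/-- Fields of endomorphisms of the tangent spaces of `M`, not necessarily continuous. -/
abbrev EndField : Type _ :=
  Π x : M, TangentSpace (𝓡 (2 * n)) x →L[ℝ] TangentSpace (𝓡 (2 * n)) x

variable [IsManifold (𝓡 (2 * n)) ∞ M]

variable (n M) in
/-- Connections on the tangent bundle of `M`. The vector `∇_v Y` at the point `x` is written
`∇ Y x v`. -/
abbrev Connection : Type _ :=
  CovariantDerivative (𝓡 (2 * n)) (EuclideanSpace ℝ (Fin (2 * n)))
    (TangentSpace (𝓡 (2 * n)) : M → Type _)

/-- The vector field `X` is smooth. -/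
def SmoothVField (X : VField n M) : Prop :=
  ContMDiff (𝓡 (2 * n)) ((𝓡 (2 * n)).prod 𝓘(ℝ, EuclideanSpace ℝ (Fin (2 * n)))) ∞
    (fun x ↦ Bundle.TotalSpace.mk' (EuclideanSpace ℝ (Fin (2 * n)))
      (E := (TangentSpace (𝓡 (2 * n)) : M → Type _)) x (X x))

/-- The vector field `X` is differentiable at the point `x`. -/
def VFieldDiffAt (X : VField n M) (x : M) : Prop :=
  MDifferentiableAt (𝓡 (2 * n)) ((𝓡 (2 * n)).prod 𝓘(ℝ, EuclideanSpace ℝ (Fin (2 * n))))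
    (fun y ↦ Bundle.TotalSpace.mk' (EuclideanSpace ℝ (Fin (2 * n)))
      (E := (TangentSpace (𝓡 (2 * n)) : M → Type _)) y (X y)) x

/-- The field `b` of bilinear forms is smooth, as a section of `T*M ⊗ T*M`. -/
def SmoothBilinField (b : BilinField n M) : Prop :=
  ContMDiff (𝓡 (2 * n))
    ((𝓡 (2 * n)).prod 𝓘(ℝ, EuclideanSpace ℝ (Fin (2 * n)) →L[ℝ]
      EuclideanSpace ℝ (Fin (2 * n)) →L[ℝ] ℝ)) ∞
    (fun x ↦ Bundle.TotalSpace.mk'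
      (EuclideanSpace ℝ (Fin (2 * n)) →L[ℝ] EuclideanSpace ℝ (Fin (2 * n)) →L[ℝ] ℝ)
      (E := fun x : M ↦
        TangentSpace (𝓡 (2 * n)) x →L[ℝ] TangentSpace (𝓡 (2 * n)) x →L[ℝ] ℝ) x (b x))

/-- The field `A` of endomorphisms is smooth, as a section of `End TM`. -/
def SmoothEndField (A : EndField n M) : Prop :=
  ContMDiff (𝓡 (2 * n))
    ((𝓡 (2 * n)).prod 𝓘(ℝ, EuclideanSpace ℝ (Fin (2 * n)) →L[ℝ]
      EuclideanSpace ℝ (Fin (2 * n)))) ∞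
    (fun x ↦ Bundle.TotalSpace.mk'
      (EuclideanSpace ℝ (Fin (2 * n)) →L[ℝ] EuclideanSpace ℝ (Fin (2 * n)))
      (E := fun x : M ↦ TangentSpace (𝓡 (2 * n)) x →L[ℝ] TangentSpace (𝓡 (2 * n)) x) x (A x))

/-- `∇ b = 0`, i.e. `v (b(Y, Z)) = b(∇_v Y, Z) + b(Y, ∇_v Z)`. -/
def IsParallelBilin (nabla : Connection n M) (b : BilinField n M) : Prop :=
  ∀ (x : M) (Y Z : VField n M), VFieldDiffAt Y x → VFieldDiffAt Z x →
    ∀ v : TangentSpace (𝓡 (2 * n)) x,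
      mfderiv (𝓡 (2 * n)) 𝓘(ℝ, ℝ) (fun y ↦ b y (Y y) (Z y)) x v =
        b x (nabla Y x v) (Z x) + b x (Y x) (nabla Z x v)

/-- The vector `(∇_v A) Y = ∇_v (A Y) - A (∇_v Y)` at the point `x`. -/
def covDerivEnd (nabla : Connection n M) (A : EndField n M) (Y : VField n M) (x : M)
    (v : TangentSpace (𝓡 (2 * n)) x) : TangentSpace (𝓡 (2 * n)) x :=
  nabla (fun y ↦ A y (Y y)) x v - A x (nabla Y x v)

/-- `∇ A = 0`. -/
def IsParallelEnd (nabla : Connection n M) (A : EndField n M) : Prop :=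
  ∀ (x : M) (Y : VField n M), VFieldDiffAt Y x →
    ∀ v : TangentSpace (𝓡 (2 * n)) x, covDerivEnd nabla A Y x v = 0

/-- The curvature `R(X, Y) Z = ∇_X ∇_Y Z - ∇_Y ∇_X Z - ∇_[X, Y] Z`, at the point `x`. -/
def curvature (nabla : Connection n M) (X Y Z : VField n M) (x : M) :
    TangentSpace (𝓡 (2 * n)) x :=
  nabla (fun y ↦ nabla Z y (Y y)) x (X x) - nabla (fun y ↦ nabla Z y (X y)) x (Y x)
    - nabla Z x (VectorField.mlieBracket (𝓡 (2 * n)) X Y x)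

/-- The connection `∇` is flat: its curvature vanishes. -/
def IsFlat (nabla : Connection n M) : Prop :=
  ∀ X Y Z : VField n M, SmoothVField X → SmoothVField Y → SmoothVField Z →
    ∀ x : M, curvature nabla X Y Z x = 0

/-- `D` is the Levi-Civita connection of the pseudo-Riemannian metric `g`: the connection,
unique by the Koszul formula, that is torsion-free and satisfies `D g = 0`. -/
structure IsLeviCivita (g : BilinField n M) (D : Connection n M) : Prop where
  torsion_free : D.torsion = 0
  metric : IsParallelBilin D g

/-- `g` is a pseudo-Riemannian metric, of any signature. -/
structure IsPseudoRiemannian (g : BilinField n M) : Prop where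
  smooth : SmoothBilinField g
  symm : ∀ (x : M) (v w : TangentSpace (𝓡 (2 * n)) x), g x v w = g x w v
  nondegenerate : ∀ (x : M) (v : TangentSpace (𝓡 (2 * n)) x), (∀ w, g x v w = 0) → v = 0

/-! ### Special `ε`-Kähler manifolds -/

/-- `(M, J, g)` is an `ε`-Kähler manifold. -/
structure IsEpsKahler (ε : ℝ) (J : EndField n M) (g : BilinField n M) : Prop where
  metric : IsPseudoRiemannian g
  smooth : SmoothEndField J
  sq : ∀ (x : M) (v : TangentSpace (𝓡 (2 * n)) x), J x (J x v) = ε • v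
  skew : ∀ (x : M) (v w : TangentSpace (𝓡 (2 * n)) x), g x (J x v) w = -g x v (J x w)
  parallel : ∃ D : Connection n M, IsLeviCivita g D ∧ IsParallelEnd D J

/-- The Kähler form `ω = ε g(J ·, ·)`. -/
def kahlerForm (ε : ℝ) (J : EndField n M) (g : BilinField n M) : BilinField n M :=
  fun x ↦ ε • (g x).comp (J x)

/-- `(M, J, g, ∇)` is an affine special `ε`-Kähler manifold. -/
structure IsAffineSpecialEpsKahler (ε : ℝ) (J : EndField n M) (g : BilinField n M)
    (nabla : Connection n M) : Prop where
  epsKahler : IsEpsKahler ε J g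
  smooth : nabla.ContMDiffCovariantDerivative ∞
  flat : IsFlat nabla
  torsion_free : nabla.torsion = 0
  symplectic : IsParallelBilin nabla (kahlerForm ε J g)
  special : ∀ (x : M) (X Y : VField n M), VFieldDiffAt X x → VFieldDiffAt Y x →
    covDerivEnd nabla J Y x (X x) = covDerivEnd nabla J X x (Y x)

/-- `(M, J, g, ∇, ξ)` is a conical affine special `ε`-Kähler manifold:
`∇ ξ = D ξ = Id`, where `D` is the Levi-Civita connection of `g`. -/
structure IsConicalAffineSpecialEpsKahler (ε : ℝ) (J : EndField n M) (g : BilinField n M)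
    (nabla : Connection n M) (ξ : VField n M) : Prop where
  affineSpecial : IsAffineSpecialEpsKahler ε J g nabla
  smooth : SmoothVField ξ
  nabla_eq_id : ∀ (x : M) (v : TangentSpace (𝓡 (2 * n)) x), nabla ξ x v = v
  leviCivita_eq_id : ∃ D : Connection n M, IsLeviCivita g D ∧
    ∀ (x : M) (v : TangentSpace (𝓡 (2 * n)) x), D ξ x v = v

/-! ### Kählerian Lagrangian immersions -/

/-- The differential `dφ_x v ∈ V` of a map `φ : M → V = ℂ_ε^{2n}`. -/
def epsDeriv {ε : ℝ} (φ : M → EpsV ε n) (x : M) (v : TangentSpace (𝓡 (2 * n)) x) : EpsV ε n :=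
  fun a ↦ ⟨mfderiv (𝓡 (2 * n)) 𝓘(ℝ, ℝ) (fun y ↦ (φ y a).re) x v,
    mfderiv (𝓡 (2 * n)) 𝓘(ℝ, ℝ) (fun y ↦ (φ y a).im) x v⟩

/-- The restriction of `φ` to the open set `U` is an `ε`-Kählerian Lagrangian immersion of
the `ε`-complex manifold `(U, J)` into `V`: a holomorphic immersion such that the
pullback of `γ` is non-degenerate and the pullback of `Ω` is zero. -/
structure IsKahlerianLagrangianImmersionOn {ε : ℝ} (J : EndField n M) (φ : M → EpsV ε n)
    (U : Set M) : Prop where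
  smooth_re : ∀ a, ContMDiffOn (𝓡 (2 * n)) 𝓘(ℝ, ℝ) ∞ (fun y ↦ (φ y a).re) U
  smooth_im : ∀ a, ContMDiffOn (𝓡 (2 * n)) 𝓘(ℝ, ℝ) ∞ (fun y ↦ (φ y a).im) U
  immersion : ∀ x ∈ U, Function.Injective (epsDeriv φ x)
  holomorphic : ∀ x ∈ U, ∀ v : TangentSpace (𝓡 (2 * n)) x,
    epsDeriv φ x (J x v) = fun a ↦ epsI ε * epsDeriv φ x v a
  kahlerian : ∀ x ∈ U, ∀ v : TangentSpace (𝓡 (2 * n)) x,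
    (∀ w, stdGamma (epsDeriv φ x v) (epsDeriv φ x w) = 0) → v = 0
  lagrangian : ∀ x ∈ U, ∀ v w : TangentSpace (𝓡 (2 * n)) x,
    stdOmega (epsDeriv φ x v) (epsDeriv φ x w) = 0

/-! ### Special affine coordinates -/

/-- `q` is a system of smooth local coordinates `(q^a) = (x^i, y_i)` of `M`, defined on the open
set `q.source`. The coordinate `x^i` has index `Sum.inl i`, and `y_i` has index `Sum.inr i`. -/
def IsSmoothCoords (q : OpenPartialHomeomorph M (Fin n ⊕ Fin n → ℝ)) : Prop :=
  ContMDiffOn (𝓡 (2 * n)) 𝓘(ℝ, Fin n ⊕ Fin n → ℝ) ∞ q q.source ∧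
    ContMDiffOn 𝓘(ℝ, Fin n ⊕ Fin n → ℝ) (𝓡 (2 * n)) ∞ q.symm q.target

/-- The coordinate vector field `∂/∂q^a` on `q.source` (its values elsewhere are irrelevant). -/
def coordField (q : OpenPartialHomeomorph M (Fin n ⊕ Fin n → ℝ)) (a : Fin n ⊕ Fin n) :
    VField n M :=
  fun x ↦ (mfderiv (𝓡 (2 * n)) 𝓘(ℝ, Fin n ⊕ Fin n → ℝ) q x).inverse
    (Pi.single a 1 : Fin n ⊕ Fin n → ℝ)

/-- `q` is a system of `∇`-affine local coordinates: `∇ (∂/∂q^a) = 0` on `q.source`. -/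
def IsAffineCoords (nabla : Connection n M)
    (q : OpenPartialHomeomorph M (Fin n ⊕ Fin n → ℝ)) : Prop :=
  IsSmoothCoords q ∧ ∀ x ∈ q.source, ∀ a, nabla (coordField q a) x = 0

/-- `q = (x^i, y_i)` is a system of special affine coordinates: the real part of an
`ε`-Kählerian Lagrangian immersion `φ` of `q.source` which induces there the special geometric
data, that is, `g` is the pullback of `g_V = Re γ`, and the coordinates `q = Re φ`
are `∇`-affine. -/
def IsSpecialAffineCoords (ε : ℝ) (J : EndField n M) (g : BilinField n M)
    (nabla : Connection n M) (q : OpenPartialHomeomorph M (Fin n ⊕ Fin n → ℝ)) : Prop :=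
  IsAffineCoords nabla q ∧ ∃ φ : M → EpsV ε n,
    IsKahlerianLagrangianImmersionOn J φ q.source ∧
    (∀ x ∈ q.source, ∀ v w : TangentSpace (𝓡 (2 * n)) x,
      g x v w = (stdGamma (epsDeriv φ x v) (epsDeriv φ x w)).re) ∧
    ∀ x ∈ q.source, ∀ a, q x a = (φ x a).re

/-- `q` is a system of conical special affine coordinates: special affine coordinates
in which `ξ = ∑ q^a ∂/∂q^a`. -/
def IsConicalSpecialAffineCoords (ε : ℝ) (J : EndField n M) (g : BilinField n M)
    (nabla : Connection n M) (ξ : VField n M)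
    (q : OpenPartialHomeomorph M (Fin n ⊕ Fin n → ℝ)) : Prop :=
  IsSpecialAffineCoords ε J g nabla q ∧
    ∀ x ∈ q.source, ξ x = ∑ a, q x a • coordField q a x

end Manifold

end

end SpecialGeometry

/-! Flatness of `∇` gives local parallel frames, and everything else is read off from them. In a
chart `∇ = d + Γ`, and vanishing curvature means `dΓ + Γ ∧ Γ = 0`. The equation `dS = -Γ S` is
solved by integrating along rays from a base point; flatness shows, via Grönwall, that this radial
solution satisfies the equation in all directions (`exists_gauge`). The columns of `S` are a
parallel frame, with dual coframe `θ` satisfying `d(θ(Y)) = θ(∇Y)` (`exists_isParallelFrameOn`).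
Since `∇ω = 0`, the form `ω` has constant coefficients in such a frame, so a constant change of
basis gives `ω = 2 ∑ dx^i ∧ dy_i` (`exists_symplectic_frame`).

Existence: the cone condition makes explicit primitives available. From `∇ξ = Id` follows `d(θ(ξ)) =
θ`, so `q = θ(ξ)` are affine coordinates with `ξ = ∑ q^a ∂/∂q^a`. As `∇` and `D` are torsion-free
and agree on `ξ`, also `∇_ξ = D_ξ`; hence `∇_ξ J = 0`, and the symmetry of `∇J` gives `∇(Jξ) = J`
(`connection_J_xi`). So `φ = θ(ξ) + i_ε ε θ(Jξ)` has differential `θ + i_ε ε θ ∘ J`, which is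
holomorphic; the relations between `g`, `ω` and `J` make `φ` Lagrangian with `g = Re φ^*γ`.

Uniqueness: two affine systems have locally constant Jacobian `A`. Both satisfy `ω = 2 ∑ dx^i ∧
dy_i`, because `φ` is Lagrangian, so `A` is symplectic. No translation occurs, because `q = dq(ξ)`
for conical coordinates.

Converse: a real symplectic matrix acts on `V` commuting with `i_ε` and conjugation and preserving
`Ω`, hence `γ`; so `Aφ` induces the same data as `φ`. -/

namespace SpecialGeometry

open Metric Filter
open scoped Topology

/-! ### Parallel gauges of flat connection forms. -/

section Gauge

variable {E 𝔸 : Type*} [NormedAddCommGroup E] [NormedSpace ℝ E]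
  [NormedRing 𝔸] [NormedAlgebra ℝ 𝔸]

/-- Linear differential equations with small coefficients are solvable on `[0, 1]`. -/
theorem exists_solution_linear_ode [CompleteSpace 𝔸] {A : ℝ → 𝔸} (hA : ContinuousOn A (Icc 0 1))
    (hA' : ∀ t ∈ Icc (0 : ℝ) 1, ‖A t‖ * (‖(1 : 𝔸)‖ + 1) ≤ 1) :
    ∃ R : ℝ → 𝔸, R 0 = 1 ∧
      ∀ t ∈ Icc (0 : ℝ) 1, HasDerivWithinAt R (-(A t * R t)) (Icc 0 1) t := by
  have h0 : (0 : ℝ) ∈ Icc (0 : ℝ) 1 := by simp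
  have hA1 : ∀ t ∈ Icc (0 : ℝ) 1, ‖A t‖ ≤ 1 := fun t ht ↦ by
    nlinarith [hA' t ht, norm_nonneg (A t), norm_nonneg (1 : 𝔸)]
  -- Picard–Lindelöf on the ball of radius 1 about `1`: speed at most 1 keeps solutions inside for
  -- the whole unit interval. The norm of `1` stays in the bound because it need not equal 1 (it is
  -- 0 in the zero ring).
  have hpl : IsPicardLindelof (fun t Y ↦ -(A t * Y)) (tmin := 0) (tmax := 1) ⟨0, h0⟩
      (1 : 𝔸) 1 0 1 1 := by
    refine ⟨fun t ht ↦ ?_, fun x hx ↦ ?_, fun t ht x hx ↦ ?_, ?_⟩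
    · refine LipschitzOnWith.of_dist_le_mul fun x _ y _ ↦ ?_
      rw [dist_neg_neg, dist_eq_norm, ← mul_sub, dist_eq_norm]
      refine (norm_mul_le _ _).trans ?_
      exact mul_le_mul_of_nonneg_right (hA1 t ht) (norm_nonneg _)
    · exact (hA.mul continuousOn_const).neg
    · rw [norm_neg]
      refine (norm_mul_le _ _).trans ?_
      have hx' : ‖x‖ ≤ ‖(1 : 𝔸)‖ + 1 := by
        have : ‖x - 1‖ ≤ 1 := by simpa [dist_eq_norm] using hx
        calc ‖x‖ = ‖1 + (x - 1)‖ := by rw [add_sub_cancel]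
          _ ≤ _ := (norm_add_le _ _).trans (by gcongr)
      exact (mul_le_mul_of_nonneg_left hx' (norm_nonneg _)).trans (hA' t ht)
    · simp
  exact hpl.exists_eq_forall_mem_Icc_hasDerivWithinAt₀

/-- A second order Taylor estimate for a map with Lipschitz derivative. -/
theorem norm_sub_sub_fderiv_le {F : Type*} [NormedAddCommGroup F] [NormedSpace ℝ F]
    {f : E → F} {s : Set E} (hs : Convex ℝ s) (hf : ∀ x ∈ s, DifferentiableAt ℝ f x) {C : ℝ}
    (hC : 0 ≤ C)
    (hL : ∀ x ∈ s, ∀ y ∈ s, ‖fderiv ℝ f x - fderiv ℝ f y‖ ≤ C * ‖x - y‖) {y k : E}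
    (hy : y ∈ s) (hyk : y + k ∈ s) :
    ‖f (y + k) - f y - fderiv ℝ f y k‖ ≤ C * ‖k‖ * ‖k‖ := by
  have hseg : segment ℝ y (y + k) ⊆ s := hs.segment_subset hy hyk
  have := (convex_segment y (y + k)).norm_image_sub_le_of_norm_hasFDerivWithin_le'
    (f := f) (f' := fderiv ℝ f) (φ := fderiv ℝ f y) (C := C * ‖k‖)
    (fun x hx ↦ (hf x (hseg hx)).hasFDerivAt.hasFDerivWithinAt) (fun x hx ↦ ?_)
    (left_mem_segment ℝ y (y + k)) (right_mem_segment ℝ y (y + k))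
  · simpa using this
  · refine (hL x (hseg hx) y hy).trans (mul_le_mul_of_nonneg_left ?_ hC)
    rw [segment_eq_image'] at hx
    obtain ⟨θ, hθ, rfl⟩ := hx
    simp only [add_sub_cancel_left, norm_smul, Real.norm_eq_abs, abs_of_nonneg hθ.1]
    exact mul_le_of_le_one_left (norm_nonneg _) hθ.2

/-- The algebra behind `norm_radial_sub_le`. With `a = Γ(x)`, `b = Γ(h)`, `c = ∂_hΓ(x)`, `d =
∂_xΓ(h)`, `e = ∂_hΓ(h)` and `f` a Taylor remainder, the left side is the defect of `P` as a solution
along the ray to `x + h`. Flatness cancels the terms linear in `h`, so only quadratic ones remain.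
-/
theorem flat_defect_eq {a b c d e f R P : 𝔸} {t : ℝ} (hP : P = R - t • (b * R))
    (hflat : c - d + b * a - a * b = 0) :
    (-(a * R) - ((b + t • d) * R + t • (b * -(a * R))))
        + (a + b + t • (c + e) + f) * P
      = -(t • (b * (b * R))) + t • (e * R) - (t * t) • ((c + e) * (b * R)) + f * P := by
  have hd : d = c + b * a - a * b := by
    have : c - d + b * a - a * b + d = d := by rw [hflat, zero_add]
    rw [← this]; abel
  subst hd
  subst hP
  simp only [add_mul, mul_sub, sub_mul, smul_mul_assoc, mul_smul_comm, smul_add, smul_sub,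
    mul_neg, mul_assoc, smul_smul, smul_neg]
  module

/-- The solution along a ray of the radial equation of a flat connection form changes, to first
order, as a parallel section. -/
theorem norm_radial_sub_le {Γ : E → E →L[ℝ] 𝔸} {s : Set E} (hs : Convex ℝ s) (h0 : (0 : E) ∈ s)
    (hΓ : ∀ y ∈ s, DifferentiableAt ℝ Γ y)
    (hflat : ∀ y ∈ s, ∀ u v,
      fderiv ℝ Γ y u v - fderiv ℝ Γ y v u + Γ y u * Γ y v - Γ y v * Γ y u = 0)
    {C : ℝ} (hC : 0 ≤ C) (hC1 : ∀ y ∈ s, ‖Γ y‖ ≤ C) (hC2 : ∀ y ∈ s, ‖fderiv ℝ Γ y‖ ≤ C)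
    (hL : ∀ x ∈ s, ∀ y ∈ s, ‖fderiv ℝ Γ x - fderiv ℝ Γ y‖ ≤ C * ‖x - y‖)
    {x h : E} (hx : x ∈ s) (hxh : x + h ∈ s) (hxh1 : C * ‖x + h‖ ≤ 1) (hh1 : ‖h‖ ≤ 1)
    {R R' : ℝ → 𝔸} (hR0 : R 0 = 1) (hR'0 : R' 0 = 1) {N : ℝ}
    (hN : ∀ t ∈ Icc (0 : ℝ) 1, ‖R t‖ ≤ N)
    (hR : ∀ t ∈ Icc (0 : ℝ) 1, HasDerivWithinAt R (-(Γ (t • x) x * R t)) (Icc 0 1) t)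
    (hR' : ∀ t ∈ Icc (0 : ℝ) 1,
      HasDerivWithinAt R' (-(Γ (t • (x + h)) (x + h) * R' t)) (Icc 0 1) t) :
    ‖R' 1 - (R 1 - Γ x h * R 1)‖ ≤ gronwallBound 0 1 ((C * C + 3 * C + 1) * N * (‖h‖ * ‖h‖)) 1 := by
  have hts : ∀ y ∈ s, ∀ t ∈ Icc (0 : ℝ) 1, t • y ∈ s := fun y hy t ht ↦
    hs.smul_mem_of_zero_mem h0 hy ht
  have hN0 : 0 ≤ N := (norm_nonneg _).trans (hN 0 (by simp))
  -- `P` is what `R'` would be to first order in `h` if the radial solution were parallel in every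
  -- direction.
  set P : ℝ → 𝔸 := fun t ↦ R t - t • (Γ (t • x) h * R t) with hPdef
  set P' : ℝ → 𝔸 := fun t ↦ -(Γ (t • x) x * R t) -
    ((Γ (t • x) h + t • fderiv ℝ Γ (t • x) x h) * R t +
      t • (Γ (t • x) h * -(Γ (t • x) x * R t))) with hP'def
  have hP : ∀ t ∈ Icc (0 : ℝ) 1, HasDerivWithinAt P (P' t) (Icc 0 1) t := fun t ht ↦ by
    have h1 : HasDerivAt (fun t : ℝ ↦ t • x) x t := by
      simpa using (hasDerivAt_id t).smul_const x
    have h2 : HasDerivAt (fun t : ℝ ↦ Γ (t • x)) (fderiv ℝ Γ (t • x) x) t :=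
      ((hΓ _ (hts x hx t ht)).hasFDerivAt).comp_hasDerivAt t h1
    have h3 : HasDerivAt (fun t : ℝ ↦ Γ (t • x) h) (fderiv ℝ Γ (t • x) x h) t := by
      simpa using h2.clm_apply (hasDerivAt_const t h)
    have h4 := (hR t ht).sub
      ((hasDerivWithinAt_id t (Icc 0 1)).smul (h3.hasDerivWithinAt.mul (hR t ht)))
    refine h4.congr_deriv ?_
    simp only [hP'def, id, one_smul, smul_add, add_mul, smul_mul_assoc]
    abel
  have hW : ∀ t ∈ Icc (0 : ℝ) 1, HasDerivWithinAt (fun t ↦ R' t - P t)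
      (-(Γ (t • (x + h)) (x + h) * R' t) - P' t) (Icc 0 1) t :=
    fun t ht ↦ (hR' t ht).sub (hP t ht)
  -- The Grönwall rate 1 comes from `C * ‖x + h‖ ≤ 1`. The constant `C² + 3C + 1` collects the four
  -- defect terms: `C²`, `C`, `C` and `1 + C`.
  have key := norm_le_gronwallBound_of_norm_deriv_right_le (δ := 0) (K := 1)
    (ε := (C * C + 3 * C + 1) * N * (‖h‖ * ‖h‖)) (a := 0) (b := 1)
    (fun t ht ↦ (hW t ht).continuousWithinAt)
    (fun t ht ↦ (hW t ⟨ht.1, ht.2.le⟩).mono_of_mem_nhdsWithin (Icc_mem_nhdsGE_of_mem ht))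
    (by simp [hPdef, hR0, hR'0]) (fun t ht ↦ ?_) 1 (by simp)
  · simpa [hPdef] using key
  have ht' : t ∈ Icc (0 : ℝ) 1 := ⟨ht.1, ht.2.le⟩
  have hy := hts x hx t ht'
  have hyh : t • x + t • h ∈ s := by rw [← smul_add]; exact hts _ hxh t ht'
  set y := t • x with hydef
  have hT := norm_sub_sub_fderiv_le hs hΓ hC hL hy hyh
  set G := Γ (y + t • h) - Γ y - fderiv ℝ Γ y (t • h) with hG
  have hth : ‖t • h‖ ≤ ‖h‖ := by
    rw [norm_smul, Real.norm_eq_abs, abs_of_nonneg ht.1]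
    exact mul_le_of_le_one_left (norm_nonneg _) ht.2.le
  have hGn : ‖G‖ ≤ C * (‖h‖ * ‖h‖) := hT.trans (by rw [mul_assoc]; gcongr)
  have hexp : Γ (t • (x + h)) (x + h) = Γ y x + Γ y h +
      t • (fderiv ℝ Γ y h x + fderiv ℝ Γ y h h) + G (x + h) := by
    have : Γ (t • (x + h)) = Γ y + t • fderiv ℝ Γ y h + G := by
      rw [hG, smul_add, map_smul]; abel
    rw [this]
    simp only [add_apply, smul_apply, map_add, smul_add]
    abel
  have hdef := flat_defect_eq (a := Γ y x) (b := Γ y h) (c := fderiv ℝ Γ y h x)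
    (d := fderiv ℝ Γ y x h) (e := fderiv ℝ Γ y h h) (f := G (x + h)) (R := R t) (P := P t) (t := t)
    rfl (hflat y hy h x)
  have hsplit : -(Γ (t • (x + h)) (x + h) * R' t) - P' t =
      -(Γ (t • (x + h)) (x + h) * (R' t - P t)) - (P' t + Γ (t • (x + h)) (x + h) * P t) := by
    rw [mul_sub]; abel
  have hB : ‖Γ (t • (x + h)) (x + h)‖ ≤ 1 := ((Γ _).le_opNorm _).trans
    ((mul_le_mul_of_nonneg_right (hC1 _ (hts _ hxh t ht')) (norm_nonneg _)).trans hxh1)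
  rw [hsplit]
  refine (norm_sub_le _ _).trans (add_le_add ?_ ?_)
  · rw [norm_neg]
    exact (norm_mul_le _ _).trans (mul_le_mul_of_nonneg_right hB (norm_nonneg _))
  have hb : ‖Γ y h‖ ≤ C * ‖h‖ := ((Γ y).le_opNorm h).trans
    (mul_le_mul_of_nonneg_right (hC1 y hy) (norm_nonneg _))
  have he : ‖fderiv ℝ Γ y h h‖ ≤ C * ‖h‖ * ‖h‖ := ((fderiv ℝ Γ y h).le_opNorm h).trans
    (mul_le_mul_of_nonneg_right (((fderiv ℝ Γ y).le_opNorm h).trans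
    (mul_le_mul_of_nonneg_right (hC2 y hy) (norm_nonneg _))) (norm_nonneg _))
  -- The factor `C * ‖x + h‖ ≤ 1` is absorbed, leaving a bound linear in `h`.
  have hc : ‖fderiv ℝ Γ y h x + fderiv ℝ Γ y h h‖ ≤ ‖h‖ := by
    rw [← map_add]
    refine ((fderiv ℝ Γ y h).le_opNorm _).trans ?_
    have := mul_le_mul_of_nonneg_right (((fderiv ℝ Γ y).le_opNorm h).trans
      (mul_le_mul_of_nonneg_right (hC2 y hy) (norm_nonneg _))) (norm_nonneg (x + h))
    refine this.trans ?_
    nlinarith [norm_nonneg h]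
  have hRN := hN t ht'
  have hbR : ‖Γ y h * R t‖ ≤ C * ‖h‖ * N :=
    (norm_mul_le _ _).trans (mul_le_mul hb hRN (norm_nonneg _) (by positivity))
  have hPn : ‖P t‖ ≤ N + C * N := by
    refine (norm_sub_le _ _).trans (add_le_add hRN ?_)
    rw [norm_smul, Real.norm_eq_abs, abs_of_nonneg ht.1]
    refine (mul_le_of_le_one_left (norm_nonneg _) ht.2.le).trans (hbR.trans ?_)
    gcongr
    exact mul_le_of_le_one_right hC hh1
  have hf : ‖G (x + h) * P t‖ ≤ (‖h‖ * ‖h‖) * (N + C * N) := by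
    refine (norm_mul_le _ _).trans (mul_le_mul ?_ hPn (norm_nonneg _) (by positivity))
    refine (G.le_opNorm _).trans ((mul_le_mul_of_nonneg_right hGn (norm_nonneg _)).trans ?_)
    nlinarith [mul_nonneg (norm_nonneg h) (norm_nonneg h)]
  have hre : P' t + Γ (t • (x + h)) (x + h) * P t = -(t • (Γ y h * (Γ y h * R t)))
      + t • (fderiv ℝ Γ y h h * R t)
      - (t * t) • ((fderiv ℝ Γ y h x + fderiv ℝ Γ y h h) * (Γ y h * R t)) + G (x + h) * P t := by
    rw [← hdef, hexp]
  have hsm : ∀ (c : ℝ) (Z : 𝔸), c ∈ Icc (0 : ℝ) 1 → ‖c • Z‖ ≤ ‖Z‖ := fun c Z hc ↦ by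
    rw [norm_smul, Real.norm_eq_abs, abs_of_nonneg hc.1]
    exact mul_le_of_le_one_left (norm_nonneg _) hc.2
  have n1 : ‖t • (Γ y h * (Γ y h * R t))‖ ≤ (C * ‖h‖) * (C * ‖h‖ * N) :=
    (hsm _ _ ht').trans ((norm_mul_le _ _).trans
      (mul_le_mul hb hbR (norm_nonneg _) (by positivity)))
  have n2 : ‖t • (fderiv ℝ Γ y h h * R t)‖ ≤ (C * ‖h‖ * ‖h‖) * N :=
    (hsm _ _ ht').trans ((norm_mul_le _ _).trans
      (mul_le_mul he hRN (norm_nonneg _) (by positivity)))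
  have n3 : ‖(t * t) • ((fderiv ℝ Γ y h x + fderiv ℝ Γ y h h) * (Γ y h * R t))‖ ≤
      ‖h‖ * (C * ‖h‖ * N) :=
    (hsm _ _ ⟨mul_nonneg ht.1 ht.1, mul_le_one₀ ht.2.le ht.1 ht.2.le⟩).trans
      ((norm_mul_le _ _).trans (mul_le_mul hc hbR (norm_nonneg _) (by positivity)))
  rw [hre]
  refine (norm_add_le _ _).trans ?_
  refine (add_le_add ((norm_sub_le _ _).trans (add_le_add ((norm_add_le _ _).trans
    (add_le_add ((norm_neg _).le.trans n1) n2)) n3)) hf).trans (le_of_eq ?_)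
  ring

/-- `S y` is the value at time 1 of the radial solution on the ray to `y`. Replacing `y` by `y + h`
changes it by `-Γ(h) S` up to `O(‖h‖²)`, which is the required derivative. -/
theorem exists_gauge_zero [CompleteSpace 𝔸] {Γ : E → E →L[ℝ] 𝔸} (hΓ : ContDiffAt ℝ 2 Γ 0)
    (hflat : ∀ᶠ y in 𝓝 (0 : E), ∀ u v,
      fderiv ℝ Γ y u v - fderiv ℝ Γ y v u + Γ y u * Γ y v - Γ y v * Γ y u = 0) :
    ∃ S : E → 𝔸, S 0 = 1 ∧ ∀ᶠ y in 𝓝 (0 : E),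
      HasFDerivAt S (-((ContinuousLinearMap.mul ℝ 𝔸).flip (S y)).comp (Γ y)) y := by
  have hd : ContDiffAt ℝ 1 (fderiv ℝ Γ) 0 := hΓ.fderiv_right (by norm_num)
  obtain ⟨K, s, hs, hK⟩ := hd.exists_lipschitzOnWith
  have e1 : ∀ᶠ y in 𝓝 (0 : E), ContDiffAt ℝ 2 Γ y := hΓ.eventually (by simp)
  have e2 : ∀ᶠ y in 𝓝 (0 : E), ‖Γ y‖ < ‖Γ 0‖ + 1 :=
    hΓ.continuousAt.norm.eventually_lt_const (by linarith)
  have e3 : ∀ᶠ y in 𝓝 (0 : E), ‖fderiv ℝ Γ y‖ < ‖fderiv ℝ Γ 0‖ + 1 := by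
    have h' : ContinuousAt (fderiv ℝ Γ) 0 := hd.continuousAt
    have h := ContinuousAt.norm (E := E →L[ℝ] E →L[ℝ] 𝔸) h'
    exact h.eventually_lt_const (by linarith)
  -- One constant bounding `Γ`, its derivative and the Lipschitz constant of that derivative near 0.
  set C : ℝ := K + (‖Γ 0‖ + 1) + (‖fderiv ℝ Γ 0‖ + 1) with hCdef
  have hK0 : (0 : ℝ) ≤ K := K.2
  have hC0 : 0 < C := by positivity
  have e4 : ∀ᶠ y in 𝓝 (0 : E), C * ‖y‖ * (‖(1 : 𝔸)‖ + 1) < 1 := by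
    have : Continuous fun y : E ↦ C * ‖y‖ * (‖(1 : 𝔸)‖ + 1) := by fun_prop
    exact this.continuousAt.eventually_lt_const (by simp)
  obtain ⟨r, hr, hball⟩ := Metric.eventually_nhds_iff_ball.1
    ((((e1.and e2).and e3).and e4).and (hflat.and hs))
  set B := ball (0 : E) r
  have h0B : (0 : E) ∈ B := mem_ball_self hr
  have hBconv : Convex ℝ B := convex_ball _ _
  have hts : ∀ y ∈ B, ∀ t ∈ Icc (0 : ℝ) 1, t • y ∈ B := fun y hy t ht ↦
    hBconv.smul_mem_of_zero_mem h0B hy ht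
  have hC1 : ∀ y ∈ B, ‖Γ y‖ ≤ C := fun y hy ↦ by
    have := (hball y hy).1.1.1.2
    have h2 := norm_nonneg (fderiv ℝ Γ 0)
    rw [hCdef]; linarith
  have hC2 : ∀ y ∈ B, ‖fderiv ℝ Γ y‖ ≤ C := fun y hy ↦ by
    have := (hball y hy).1.1.2
    have h2 := norm_nonneg (Γ 0)
    rw [hCdef]; linarith
  have hL : ∀ x ∈ B, ∀ y ∈ B, ‖fderiv ℝ Γ x - fderiv ℝ Γ y‖ ≤ C * ‖x - y‖ := fun x hx y hy ↦ by
    have := hK.dist_le_mul x (hball x hx).2.2 y (hball y hy).2.2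
    rw [dist_eq_norm, dist_eq_norm] at this
    refine this.trans (mul_le_mul_of_nonneg_right ?_ (norm_nonneg _))
    have h2 := norm_nonneg (fderiv ℝ Γ 0)
    have h3 := norm_nonneg (Γ 0)
    rw [hCdef]; linarith
  have hdiff : ∀ y ∈ B, DifferentiableAt ℝ Γ y := fun y hy ↦
    (hball y hy).1.1.1.1.differentiableAt (by norm_num)
  have hsmall : ∀ y ∈ B, C * ‖y‖ ≤ 1 := fun y hy ↦ by
    have := (hball y hy).1.2
    nlinarith [norm_nonneg (1 : 𝔸), mul_nonneg hC0.le (norm_nonneg y)]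
  -- Outside the ball the solution is set to 1, only to make the choice of `R` total.
  have hsol : ∀ y : E, ∃ R : ℝ → 𝔸, R 0 = 1 ∧ (y ∈ B → ∀ t ∈ Icc (0 : ℝ) 1,
      HasDerivWithinAt R (-(Γ (t • y) y * R t)) (Icc 0 1) t) := fun y ↦ by
    by_cases hy : y ∈ B
    · obtain ⟨R, hR0, hR⟩ := exists_solution_linear_ode (A := fun t ↦ Γ (t • y) y) (𝔸 := 𝔸)
        (fun t ht ↦ by
          have h1 : ContinuousAt Γ (t • y) := (hdiff _ (hts y hy t ht)).continuousAt
          have h2 : ContinuousAt (fun t : ℝ ↦ Γ (t • y)) t :=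
            ContinuousAt.comp (f := fun t : ℝ ↦ t • y) h1 (by fun_prop)
          exact (h2.clm_apply continuousAt_const).continuousWithinAt)
        (fun t ht ↦ by
          have h1 : ‖Γ (t • y) y‖ ≤ C * ‖y‖ := ((Γ (t • y)).le_opNorm y).trans
            (mul_le_mul_of_nonneg_right (hC1 _ (hts y hy t ht)) (norm_nonneg _))
          have := (hball y hy).1.2
          exact (mul_le_mul_of_nonneg_right h1 (by positivity)).trans this.le)
      exact ⟨R, hR0, fun _ ↦ hR⟩
    · exact ⟨fun _ ↦ 1, rfl, fun h ↦ absurd h hy⟩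
  choose R hR0 hR using hsol
  have hone : (1 : ℝ) ∈ Icc (0 : ℝ) 1 := by simp
  refine ⟨fun y ↦ R y 1, ?_, ?_⟩
  -- On the degenerate ray to 0 the coefficient vanishes, so the solution stays at 1.
  · have h1 := constant_of_has_deriv_right_zero (f := R 0) (a := 0) (b := 1)
      (fun t ht ↦ (hR 0 h0B t ht).continuousWithinAt) (fun t ht ↦ by
        have := hR 0 h0B t ⟨ht.1, ht.2.le⟩
        simp only [map_zero, zero_mul, neg_zero] at this
        exact this.mono_of_mem_nhdsWithin (Icc_mem_nhdsGE_of_mem ht)) 1 hone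
    simpa [hR0] using h1
  · filter_upwards [isOpen_ball.mem_nhds h0B] with x hx
    -- The bound `N` depends on `x` only, so the error estimate is uniform in `h`.
    obtain ⟨N, hN⟩ := isCompact_Icc.exists_bound_of_continuousOn
      (f := R x) (fun t ht ↦ (hR x hx t ht).continuousWithinAt)
    have hbd : ∀ᶠ h in 𝓝 (0 : E), ‖R (x + h) 1 - (R x 1 - Γ x h * R x 1)‖ ≤
        gronwallBound 0 1 ((C * C + 3 * C + 1) * N * (‖h‖ * ‖h‖)) 1 := by
      have h1 : ∀ᶠ h in 𝓝 (0 : E), x + h ∈ B :=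
        (continuous_const.add continuous_id).continuousAt.eventually_mem
          (by simpa using isOpen_ball.mem_nhds hx)
      have h2 : ∀ᶠ h in 𝓝 (0 : E), ‖h‖ < 1 :=
        continuous_norm.continuousAt.eventually_lt_const (by simp)
      filter_upwards [h1, h2] with h h1 h2
      exact norm_radial_sub_le hBconv h0B hdiff (fun y hy ↦ (hball y hy).2.1) hC0.le hC1 hC2 hL hx
        h1 (hsmall _ h1) h2.le (hR0 _) (hR0 _) hN (hR x hx) (hR _ h1)
    rw [hasFDerivAt_iff_isLittleO_nhds_zero]
    have hO : (fun h ↦ R (x + h) 1 - R x 1 -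
        (-((ContinuousLinearMap.mul ℝ 𝔸).flip (R x 1)).comp (Γ x)) h) =O[𝓝 0]
          fun h : E ↦ ‖h‖ * ‖h‖ := by
      refine Asymptotics.IsBigO.of_bound (((C * C + 3 * C + 1) * N) * (Real.exp 1 - 1)) ?_
      filter_upwards [hbd] with h hh
      rw [gronwallBound_of_K_ne_0 one_ne_zero] at hh
      have e : R (x + h) 1 - R x 1 - (-((ContinuousLinearMap.mul ℝ 𝔸).flip (R x 1)).comp (Γ x)) h
        = R (x + h) 1 - (R x 1 - Γ x h * R x 1) := by
        simp; abel
      rw [e, norm_mul, norm_norm]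
      refine hh.trans (le_of_eq ?_)
      simp; ring
    refine hO.trans_isLittleO ?_
    have : (fun h : E ↦ ‖h‖ * ‖h‖) =o[𝓝 0] fun h : E ↦ (1 : ℝ) * ‖h‖ := by
      refine Asymptotics.IsLittleO.mul_isBigO ?_ (Asymptotics.isBigO_refl _ _)
      rw [Asymptotics.isLittleO_one_iff]
      simpa using (continuous_norm (E := E)).tendsto 0
    rw [← Asymptotics.isLittleO_norm_right]
    simpa using this

/-- A flat connection form admits, near any point, an invertible parallel section, which is as
smooth as the form. -/
theorem exists_gauge [CompleteSpace 𝔸] {Γ : E → E →L[ℝ] 𝔸} {x₀ : E} {s : Set E} (hs : s ∈ 𝓝 x₀)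
    (hΓ : ContDiffOn ℝ ∞ Γ s)
    (hflat : ∀ y ∈ s, ∀ u v,
      fderiv ℝ Γ y u v - fderiv ℝ Γ y v u + Γ y u * Γ y v - Γ y v * Γ y u = 0) :
    ∃ S : E → 𝔸, ∃ t ⊆ s, IsOpen t ∧ x₀ ∈ t ∧ ContDiffOn ℝ ∞ S t ∧ ∀ y ∈ t, IsUnit (S y) ∧
      ∀ v, fderiv ℝ S y v = -(Γ y v * S y) := by
  have hadd : ContDiffAt ℝ 2 (fun y ↦ Γ (x₀ + y)) 0 := by
    have h1 : ContDiffAt ℝ 2 Γ (x₀ + 0) := by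
      rw [add_zero]; exact (hΓ.contDiffAt hs).of_le (WithTop.coe_le_coe.2 le_top)
    exact h1.comp (0 : E) (contDiffAt_const.add contDiffAt_id)
  have hev : ∀ᶠ y in 𝓝 (0 : E), x₀ + y ∈ s :=
    (continuous_const.add continuous_id).continuousAt.eventually_mem (by simpa using hs)
  obtain ⟨S, hS0, hS⟩ := exists_gauge_zero hadd (by
    filter_upwards [hev] with y hy u v
    simp only [fderiv_comp_add_left]
    exact hflat _ hy u v)
  have hcont : ContinuousAt (fun y ↦ S (y - x₀)) x₀ := by
    have h1 : ContinuousAt S (x₀ - x₀) := by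
      rw [sub_self]; exact hS.self_of_nhds.continuousAt
    exact ContinuousAt.comp (f := fun y : E ↦ y - x₀) h1 (by fun_prop)
  have hunit : ∀ᶠ y in 𝓝 x₀, IsUnit (S (y - x₀)) := by
    refine hcont.eventually_mem (Units.isOpen.mem_nhds ?_)
    simp [hS0]
  have hsub : Tendsto (fun y : E ↦ y - x₀) (𝓝 x₀) (𝓝 0) := by
    have : ContinuousAt (fun y : E ↦ y - x₀) x₀ := by fun_prop
    simpa [ContinuousAt] using this
  obtain ⟨t, ht, hto, hxt⟩ := _root_.mem_nhds_iff.1 (((hsub.eventually hS).and hunit).and hs)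
  have hder : ∀ y ∈ t, HasFDerivAt (fun y ↦ S (y - x₀))
      (-((ContinuousLinearMap.mul ℝ 𝔸).flip (S (y - x₀))).comp (Γ y)) y := fun y hy ↦ by
    have h1 := (ht hy).1.1
    simp only [add_sub_cancel] at h1
    exact h1.comp y ((hasFDerivAt_id y).sub_const x₀)
  refine ⟨fun y ↦ S (y - x₀), t, fun y hy ↦ (ht hy).2, hto, hxt, ?_, fun y hy ↦
    ⟨(ht hy).1.2, fun v ↦ by rw [(hder y hy).fderiv]; rfl⟩⟩
  rw [contDiffOn_infty]
  intro k
  -- Bootstrapping: if `S` is `C^k`, then so is `dS = -Γ S`, whence `S` is `C^{k+1}`.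
  induction k with
  | zero => exact contDiffOn_zero.2 fun y hy ↦ (hder y hy).continuousAt.continuousWithinAt
  | succ k ih =>
    push_cast
    rw [contDiffOn_succ_iff_fderiv_of_isOpen hto]
    refine ⟨fun y hy ↦ (hder y hy).differentiableAt.differentiableWithinAt, by simp, ?_⟩
    refine ContDiffOn.congr ?_ fun y hy ↦ (hder y hy).fderiv
    refine (ContDiffOn.clm_comp ?_ ((hΓ.mono fun y hy ↦ (ht hy).2).of_le
      (by exact_mod_cast le_top))).neg
    exact (ContinuousLinearMap.contDiff _).comp_contDiffOn ih

end Gauge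
end SpecialGeometry

/-! ### Vector fields and Christoffel symbols in a chart. -/

namespace SpecialGeometry

open Metric Filter Bundle
open scoped Topology

noncomputable section

section LocalCoordinates

variable {E : Type*} [NormedAddCommGroup E] [NormedSpace ℝ E]
  {M : Type*} [TopologicalSpace M] [ChartedSpace E M] [IsManifold 𝓘(ℝ, E) ∞ M]

/-- The components of a tangent vector at `x` in the chart at `p`. -/
def chartL (p x : M) : TangentSpace 𝓘(ℝ, E) x →L[ℝ] E :=
  (trivializationAt E (TangentSpace 𝓘(ℝ, E)) p).continuousLinearMapAt ℝ x

/-- The tangent vector at `x` with given components in the chart at `p`. -/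
def chartSymmL (p x : M) : E →L[ℝ] TangentSpace 𝓘(ℝ, E) x :=
  (trivializationAt E (TangentSpace 𝓘(ℝ, E)) p).symmL ℝ x

/-- The components of a vector field in the chart at `p`. -/
def toChart (p : M) (Y : Π x : M, TangentSpace 𝓘(ℝ, E) x) (x : M) : E :=
  chartL p x (Y x)

/-- The vector field with given components in the chart at `p`. -/
def ofChart (p : M) (f : M → E) (x : M) : TangentSpace 𝓘(ℝ, E) x :=
  chartSymmL p x (f x)

variable {p x : M}

theorem chartL_chartSymmL (hx : x ∈ (chartAt E p).source) (u : E) :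
    chartL p x (chartSymmL p x u) = u :=
  (trivializationAt E (TangentSpace 𝓘(ℝ, E)) p).continuousLinearMapAt_symmL hx u

theorem chartSymmL_chartL (hx : x ∈ (chartAt E p).source) (v : TangentSpace 𝓘(ℝ, E) x) :
    chartSymmL p x (chartL p x v) = v :=
  (trivializationAt E (TangentSpace 𝓘(ℝ, E)) p).symmL_continuousLinearMapAt hx v

theorem toChart_ofChart (hx : x ∈ (chartAt E p).source) (f : M → E) :
    toChart p (ofChart p f) x = f x :=
  chartL_chartSymmL hx (f x)

theorem ofChart_toChart (hx : x ∈ (chartAt E p).source) (Y : Π x : M, TangentSpace 𝓘(ℝ, E) x) :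
    ofChart p (toChart p Y) x = Y x :=
  chartSymmL_chartL hx (Y x)

theorem contMDiffAt_toChart_iff {k : ℕ∞ω}
    [ContMDiffVectorBundle k E (TangentSpace 𝓘(ℝ, E) : M → Type _) 𝓘(ℝ, E)]
    (hx : x ∈ (chartAt E p).source)
    (Y : Π x : M, TangentSpace 𝓘(ℝ, E) x) :
    CMDiffAt k (T% Y) x ↔ CMDiffAt k (toChart p Y) x := by
  rw [(trivializationAt E (TangentSpace 𝓘(ℝ, E)) p).contMDiffAt_section_iff hx]
  refine Filter.EventuallyEq.contMDiffAt_iff ?_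
  filter_upwards [(chartAt E p).open_source.mem_nhds hx] with y hy
  exact ((trivializationAt E (TangentSpace 𝓘(ℝ, E)) p).continuousLinearMapAt_apply_of_mem ℝ
    hy _).symm

theorem mdifferentiableAt_toChart_iff (hx : x ∈ (chartAt E p).source)
    (Y : Π x : M, TangentSpace 𝓘(ℝ, E) x) :
    MDiffAt (T% Y) x ↔ MDiffAt (toChart p Y) x := by
  rw [(trivializationAt E (TangentSpace 𝓘(ℝ, E)) p).mdifferentiableAt_section_iff _ _ hx]
  refine Filter.EventuallyEq.mdifferentiableAt_iff ?_
  filter_upwards [(chartAt E p).open_source.mem_nhds hx] with y hy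
  exact ((trivializationAt E (TangentSpace 𝓘(ℝ, E)) p).continuousLinearMapAt_apply_of_mem ℝ
    hy _).symm

/-- The connection on the domain of the chart at `p` for which the coordinate fields are
parallel. -/
def chartConnection (p : M) (Y : Π x : M, TangentSpace 𝓘(ℝ, E) x) (x : M) :
    TangentSpace 𝓘(ℝ, E) x →L[ℝ] TangentSpace 𝓘(ℝ, E) x :=
  (chartSymmL p x).comp (d% (toChart p Y) x)

/-- Needed so that the difference between this connection and `∇` is tensorial; that difference
defines `christoffel`. -/
theorem isCovariantDerivativeOn_chartConnection (p : M) :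
    IsCovariantDerivativeOn (I := 𝓘(ℝ, E)) (V := (TangentSpace 𝓘(ℝ, E) : M → Type _)) E
      (chartConnection (E := E) p) (chartAt E p).source where
  add {Y Y' x} hY hY' hx := by
    rw [mdifferentiableAt_toChart_iff hx] at hY hY'
    have : toChart p (Y + Y') = toChart p Y + toChart p Y' := by
      ext1 y; simp [toChart]
    simp [chartConnection, this, mvfderiv_add hY hY']
  leibniz {Y g x} hY hg hx := by
    have h1 := ofChart_toChart hx Y
    rw [mdifferentiableAt_toChart_iff hx] at hY
    have : toChart p (g • Y) = g • toChart p Y := by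
      ext1 y; simp [toChart]
    rw [ofChart] at h1
    simp only [chartConnection, this, mvfderiv_smul hg hY]
    ext v
    simp [h1]

variable [FiniteDimensional ℝ E]

/-- The Christoffel symbols of a connection in the chart at `p`: the components
`christoffel nabla p x u w` of `∇_u w` for the coordinate fields with components `u` and `w`. -/
def christoffel (nabla : CovariantDerivative 𝓘(ℝ, E) E (TangentSpace 𝓘(ℝ, E) : M → Type _))
    (p x : M) : E →L[ℝ] E →L[ℝ] E :=
  LinearMap.toContinuousBilinearMap <| LinearMap.mk₂ ℝ
    (fun u w ↦ chartL p x ((nabla.isCovariantDerivativeOn).difference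
      (isCovariantDerivativeOn_chartConnection p) x (chartSymmL p x w) (chartSymmL p x u)))
    (by simp) (by simp) (by simp) (by simp)

variable (nabla : CovariantDerivative 𝓘(ℝ, E) E (TangentSpace 𝓘(ℝ, E) : M → Type _))

theorem chartL_connection_apply (hx : x ∈ (chartAt E p).source)
    {Y : Π x : M, TangentSpace 𝓘(ℝ, E) x} (hY : MDiffAt (T% Y) x) (v : TangentSpace 𝓘(ℝ, E) x) :
    chartL p x (nabla Y x v) =
      d% (toChart p Y) x v + christoffel nabla p x (chartL p x v) (toChart p Y x) := by
  have h := IsCovariantDerivativeOn.difference_apply (nabla.isCovariantDerivativeOn)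
    (isCovariantDerivativeOn_chartConnection p) hx hY
  have h2 := congrArg (chartL p x) (congrArg (fun A ↦ A v) h)
  simp only [christoffel, toChart, LinearMap.toContinuousBilinearMap_apply, LinearMap.mk₂_apply,
    chartSymmL_chartL hx]
  rw [h2]
  simp [chartConnection, chartL_chartSymmL hx]

/-- A bump function makes local fields global. Flatness and smoothness of a connection are
conditions on global fields, but are to be applied to coordinate fields. -/
theorem contMDiff_extension [T2Space M] {Y : Π x : M, TangentSpace 𝓘(ℝ, E) x} {u : Set M}
    (hu : IsOpen u) (hY : CMDiff[u] ∞ (T% Y)) (hx : x ∈ u) :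
    ∃ Z : Π x : M, TangentSpace 𝓘(ℝ, E) x, CMDiff ∞ (T% Z) ∧ ∀ᶠ y in 𝓝 x, Z y = Y y := by
  obtain ⟨ρ, -, hρ⟩ := (SmoothBumpFunction.nhds_basis_tsupport (I := 𝓘(ℝ, E)) x).mem_iff.1
    (hu.mem_nhds hx)
  refine ⟨(ρ : M → ℝ) • Y, ContMDiffOn.smul_section_of_tsupport
    (ρ.contMDiff.contMDiffOn) hu hρ hY, ?_⟩
  filter_upwards [ρ.eventuallyEq_one] with y hy
  simp [hy]

end LocalCoordinates
end
end SpecialGeometry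

/-! ### Derivatives, brackets and smoothness of Christoffel symbols in a chart. -/

namespace SpecialGeometry

open Metric Filter Bundle
open scoped Topology

noncomputable section

section LocalCoordinates

variable {E : Type*} [NormedAddCommGroup E] [NormedSpace ℝ E]
  {M : Type*} [TopologicalSpace M] [ChartedSpace E M] [IsManifold 𝓘(ℝ, E) ∞ M]
  {F : Type*} [NormedAddCommGroup F] [NormedSpace ℝ F] {p x : M}

theorem mfderiv_chartAt (hx : x ∈ (chartAt E p).source) :
    mfderiv 𝓘(ℝ, E) 𝓘(ℝ, E) (chartAt E p) x = chartL p x := by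
  have h := TangentBundle.continuousLinearMapAt_trivializationAt (I := 𝓘(ℝ, E)) hx
  rw [chartL, h]
  simp only [mfld_simps]

theorem mdifferentiableAt_chartAt (hx : x ∈ (chartAt E p).source) :
    MDifferentiableAt 𝓘(ℝ, E) 𝓘(ℝ, E) (chartAt E p) x :=
  ((contMDiffOn_chart (n := ∞)).contMDiffAt
    ((chartAt E p).open_source.mem_nhds hx)).mdifferentiableAt
    (by simp)

theorem mdifferentiableAt_chartAt_symm (hx : x ∈ (chartAt E p).source) :
    MDifferentiableAt 𝓘(ℝ, E) 𝓘(ℝ, E) (chartAt E p).symm (chartAt E p x) :=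
  ((contMDiffOn_chart_symm (n := ∞)).contMDiffAt ((chartAt E p).open_target.mem_nhds
    ((chartAt E p).map_source hx))).mdifferentiableAt (by simp)

theorem differentiableAt_comp_chartAt_symm {h : M → F} (hx : x ∈ (chartAt E p).source)
    (hh : MDiffAt h x) : DifferentiableAt ℝ (h ∘ (chartAt E p).symm) (chartAt E p x) := by
  rw [← mdifferentiableAt_iff_differentiableAt]
  refine MDifferentiableAt.comp _ ?_ (mdifferentiableAt_chartAt_symm hx)
  rwa [(chartAt E p).left_inv hx]

theorem mdifferentiableAt_comp_chartAt {k : E → F} (hx : x ∈ (chartAt E p).source)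
    (hk : DifferentiableAt ℝ k (chartAt E p x)) : MDiffAt (fun y ↦ k (chartAt E p y)) x :=
  hk.mdifferentiableAt.comp x (mdifferentiableAt_chartAt hx)

theorem mvfderiv_comp_chartAt {k : E → F} (hx : x ∈ (chartAt E p).source)
    (hk : DifferentiableAt ℝ k (chartAt E p x)) (v : TangentSpace 𝓘(ℝ, E) x) :
    d% (fun y ↦ k (chartAt E p y)) x v = fderiv ℝ k (chartAt E p x) (chartL p x v) := by
  have h := mfderiv_comp_apply x (I' := 𝓘(ℝ, E)) (f := chartAt E p) hk.mdifferentiableAt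
    (mdifferentiableAt_chartAt hx) v
  rw [mfderiv_chartAt hx, mfderiv_eq_fderiv] at h
  exact h

theorem mvfderiv_eq_fderiv {h : M → F} (hx : x ∈ (chartAt E p).source) (hh : MDiffAt h x)
    (v : TangentSpace 𝓘(ℝ, E) x) :
    d% h x v = fderiv ℝ (h ∘ (chartAt E p).symm) (chartAt E p x) (chartL p x v) := by
  rw [← mvfderiv_comp_chartAt hx (differentiableAt_comp_chartAt_symm hx hh)]
  have : h =ᶠ[𝓝 x] fun y ↦ (h ∘ (chartAt E p).symm) (chartAt E p y) := by
    filter_upwards [(chartAt E p).open_source.mem_nhds hx] with y hy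
    simp [(chartAt E p).left_inv hy]
  simp only [mvfderiv, this.mfderiv_eq]
  rfl

theorem contDiffOn_comp_chartAt_symm {h : M → F} (hh : CMDiff[(chartAt E p).source] ∞ h) :
    ContDiffOn ℝ ∞ (h ∘ (chartAt E p).symm) (chartAt E p).target := by
  rw [← contMDiffOn_iff_contDiffOn]
  exact hh.comp contMDiffOn_chart_symm fun y hy ↦ (chartAt E p).map_target hy

theorem contMDiffOn_ofChart {f : M → E} (hf : CMDiff[(chartAt E p).source] ∞ f) :
    CMDiff[(chartAt E p).source] ∞ (T% (ofChart p f)) := fun x hx ↦ by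
  have hn := (chartAt E p).open_source.mem_nhds hx
  refine ContMDiffAt.contMDiffWithinAt ((contMDiffAt_toChart_iff hx _).2 ?_)
  refine ContMDiffAt.congr_of_eventuallyEq (hf.contMDiffAt hn) ?_
  filter_upwards [hn] with y hy using toChart_ofChart hy f

/-- Fields with constant components are pullbacks of constant fields along the chart, and pullback
commutes with the bracket. -/
theorem mlieBracket_ofChart_const [CompleteSpace E] (hx : x ∈ (chartAt E p).source) (u w : E) :
    VectorField.mlieBracket 𝓘(ℝ, E) (ofChart p fun _ ↦ u) (ofChart p fun _ ↦ w) x = 0 := by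
  have : IsManifold 𝓘(ℝ, E) (minSmoothness ℝ 2) M := by
    rw [minSmoothness_of_isRCLikeNormedField]; infer_instance
  have hpull : ∀ u : E, ofChart p (fun _ ↦ u) =ᶠ[𝓝 x]
      VectorField.mpullback 𝓘(ℝ, E) 𝓘(ℝ, E) (chartAt E p) (fun _ ↦ u) := fun u ↦ by
    filter_upwards [(chartAt E p).open_source.mem_nhds hx] with y hy
    change ofChart p (fun _ ↦ u) y = (mfderiv 𝓘(ℝ, E) 𝓘(ℝ, E) (chartAt E p) y).inverse u
    rw [mfderiv_chartAt hy]
    let e : TangentSpace 𝓘(ℝ, E) y ≃L[ℝ] E := ContinuousLinearEquiv.equivOfInverse (chartL p y)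
      (chartSymmL p y) (chartSymmL_chartL hy) (chartL_chartSymmL hy)
    have : chartL p y = (e : TangentSpace 𝓘(ℝ, E) y →L[ℝ] E) := by ext; rfl
    rw [this]
    exact (congrArg (fun A ↦ A u) (ContinuousLinearMap.inverse_equiv e)).symm
  have hc : ∀ u : E, MDifferentiableAt 𝓘(ℝ, E) (𝓘(ℝ, E).prod 𝓘(ℝ, E))
      (fun y ↦ (⟨y, u⟩ : TotalSpace E (TangentSpace 𝓘(ℝ, E) : E → Type _))) (chartAt E p x) :=
    fun u ↦ ((contMDiffAt_vectorSpace_iff_contDiffAt (n := 1)).2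
      contDiffAt_const).mdifferentiableAt (by simp)
  rw [(hpull u).mlieBracket_vectorField_eq (hpull w),
    ← VectorField.mpullback_mlieBracket (n := ∞) (hc u) (hc w)
      (contMDiffOn_chart.contMDiffAt ((chartAt E p).open_source.mem_nhds hx))
      (by
        rw [minSmoothness_of_isRCLikeNormedField]
        exact WithTop.coe_le_coe.2 le_top)]
  have hL : ∀ U W : Π y : E, TangentSpace 𝓘(ℝ, E) y,
      VectorField.mlieBracket 𝓘(ℝ, E) U W = VectorField.lieBracket ℝ U W := fun U W ↦ by
    rw [← VectorField.mlieBracketWithin_univ, VectorField.mlieBracketWithin_eq_lieBracketWithin]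
    exact VectorField.lieBracketWithin_univ
  have h0 : VectorField.lieBracket ℝ (fun _ : E ↦ u) (fun _ ↦ w) (chartAt E p x) = 0 := by
    simp [VectorField.lieBracket]
  have h1 := (congrFun (hL (fun _ ↦ u) (fun _ ↦ w)) (chartAt E p x)).trans h0
  rw [VectorField.mpullback_apply]
  erw [h1]
  exact map_zero _

variable [FiniteDimensional ℝ E]
  (nabla : CovariantDerivative 𝓘(ℝ, E) E (TangentSpace 𝓘(ℝ, E) : M → Type _))

omit [FiniteDimensional ℝ E] in
theorem connection_congr {Y Z : Π x : M, TangentSpace 𝓘(ℝ, E) x} (hY : MDiffAt (T% Y) x)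
    (hYZ : ∀ᶠ y in 𝓝 x, Z y = Y y) : nabla Z x = nabla Y x := by
  refine nabla.isCovariantDerivativeOn.congr_of_eventuallyEq ?_ hY univ_mem hYZ
  refine hY.congr_of_eventuallyEq ?_
  filter_upwards [hYZ] with y hy
  simp [hy]

theorem chartL_connection_ofChart (hx : x ∈ (chartAt E p).source) {f : M → E} (hf : MDiffAt f x)
    (v : TangentSpace 𝓘(ℝ, E) x) :
    chartL p x (nabla (ofChart p f) x v) =
      d% f x v + christoffel nabla p x (chartL p x v) (f x) := by
  have hev : toChart p (ofChart p f) =ᶠ[𝓝 x] f := by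
    filter_upwards [(chartAt E p).open_source.mem_nhds hx] with y hy using toChart_ofChart hy f
  rw [chartL_connection_apply nabla hx ((mdifferentiableAt_toChart_iff hx _).2
    (hf.congr_of_eventuallyEq hev)), toChart_ofChart hx]
  simp only [mvfderiv, hev.mfderiv_eq]
  rfl

theorem christoffel_apply (hx : x ∈ (chartAt E p).source) (u w : E) :
    christoffel nabla p x u w = chartL p x (nabla (ofChart p fun _ ↦ w) x (chartSymmL p x u)) := by
  rw [chartL_connection_ofChart nabla hx mdifferentiableAt_const, chartL_chartSymmL hx,
    mvfderiv_const]
  simp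

theorem contMDiffOn_christoffel_apply [T2Space M] [h : nabla.ContMDiffCovariantDerivative ∞]
    (u w : E) : CMDiff[(chartAt E p).source] ∞ (fun y ↦ christoffel nabla p y u w) := fun x hx ↦ by
  have hn := (chartAt E p).open_source.mem_nhds hx
  obtain ⟨Z, hZ, hZw⟩ := contMDiff_extension (chartAt E p).open_source
    (contMDiffOn_ofChart (p := p) (f := fun _ ↦ w) contMDiffOn_const) hx
  have h1 := (h.contMDiff.contMDiff (σ := Z)
    (hZ.of_le (le_of_eq rfl)).contMDiffOn).contMDiffAt (x := x) univ_mem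
  have h2 := (contMDiffOn_ofChart (p := p) (f := fun _ ↦ u) contMDiffOn_const).contMDiffAt hn
  have h3 := (contMDiffAt_toChart_iff hx _).1 (h1.clm_bundle_apply h2)
  refine (h3.congr_of_eventuallyEq ?_).contMDiffWithinAt
  filter_upwards [hn, hZw.eventually_nhds] with y hy hyZ
  have h4 := (contMDiffOn_ofChart (p := p) (f := fun _ ↦ w) contMDiffOn_const).contMDiffAt
    ((chartAt E p).open_source.mem_nhds hy)
  rw [christoffel_apply nabla hy, toChart,
    connection_congr nabla (h4.mdifferentiableAt (by simp)) hyZ]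
  rfl

theorem contDiffOn_christoffel [T2Space M] [nabla.ContMDiffCovariantDerivative ∞] :
    ContDiffOn ℝ ∞ (christoffel nabla p ∘ (chartAt E p).symm) (chartAt E p).target := by
  rw [contDiffOn_clm_apply]
  intro u
  rw [contDiffOn_clm_apply]
  intro w
  exact contDiffOn_comp_chartAt_symm (contMDiffOn_christoffel_apply nabla u w)

end LocalCoordinates
end
end SpecialGeometry

/-! ### Local parallel frames of a flat connection. -/

namespace SpecialGeometry

open Metric Filter Bundle
open scoped Topology

noncomputable section

set_option synthInstance.maxHeartbeats 400000 in
theorem fderiv_apply_apply {E F : Type*} [NormedAddCommGroup E] [NormedSpace ℝ E]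
    [NormedAddCommGroup F] [NormedSpace ℝ F]
    {Γ : E → E →L[ℝ] E →L[ℝ] F} {z : E} (hΓ : ContDiffAt ℝ ∞ Γ z) (u v w : E) :
    fderiv ℝ (fun z ↦ Γ z v w) z u = fderiv ℝ Γ z u v w :=
  congrArg (fun A ↦ A u) (((ContinuousLinearMap.apply ℝ F w).comp
    (ContinuousLinearMap.apply ℝ (E →L[ℝ] F) v)).hasFDerivAt.comp _
      (hΓ.differentiableAt (by simp)).hasFDerivAt).fderiv

section ParallelFrame

variable {E : Type*} [NormedAddCommGroup E] [NormedSpace ℝ E]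
  {M : Type*} [TopologicalSpace M] [ChartedSpace E M] [IsManifold 𝓘(ℝ, E) ∞ M]
  {F : Type*} [NormedAddCommGroup F] [NormedSpace ℝ F] {p x : M} [FiniteDimensional ℝ E]
  (nabla : CovariantDerivative 𝓘(ℝ, E) E (TangentSpace 𝓘(ℝ, E) : M → Type _))

/-- The field `∇_v w` has components `Γ(v) w`; a second covariant derivative differentiates these
and adds `Γ(u) Γ(v) w`. The fields agree with coordinate fields only near `x`, so that global
extensions are allowed. -/
theorem chartL_connection_connection [T2Space M] [nabla.ContMDiffCovariantDerivative ∞]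
    (hx : x ∈ (chartAt E p).source) (u v w : E) {Y Z : Π x : M, TangentSpace 𝓘(ℝ, E) x}
    (hY : ∀ᶠ y in 𝓝 x, Y y = ofChart p (fun _ ↦ v) y)
    (hZ : ∀ᶠ y in 𝓝 x, Z y = ofChart p (fun _ ↦ w) y) :
    chartL p x (nabla (fun y ↦ nabla Z y (Y y)) x (chartSymmL p x u)) =
      fderiv ℝ (christoffel nabla p ∘ (chartAt E p).symm) (chartAt E p x) u v w +
        christoffel nabla p x u (christoffel nabla p x v w) := by
  have hn := (chartAt E p).open_source.mem_nhds hx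
  have hΓ := (contMDiffOn_christoffel_apply (p := p) nabla v w).contMDiffAt hn
  have hΓ1 := hΓ.mdifferentiableAt (by simp)
  have hY2 : ∀ᶠ y in 𝓝 x, nabla Z y (Y y) = ofChart p (fun y ↦ christoffel nabla p y v w) y := by
    filter_upwards [hn, hY, hZ.eventually_nhds] with y hy hYy hZy
    have h4 := (contMDiffOn_ofChart (p := p) (f := fun _ ↦ w) contMDiffOn_const).contMDiffAt
      ((chartAt E p).open_source.mem_nhds hy)
    rw [connection_congr nabla (h4.mdifferentiableAt (by simp)) hZy, hYy, ofChart, ofChart,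
      christoffel_apply nabla hy, chartSymmL_chartL hy]
  have h5 := (contMDiffOn_ofChart (contMDiffOn_christoffel_apply (p := p) nabla v w)).contMDiffAt hn
  rw [connection_congr nabla (h5.mdifferentiableAt (by simp)) hY2,
    chartL_connection_ofChart nabla hx hΓ1, mvfderiv_eq_fderiv hx hΓ1, chartL_chartSymmL hx]
  congr 1
  exact fderiv_apply_apply ((contDiffOn_christoffel nabla).contDiffAt
    ((chartAt E p).open_target.mem_nhds ((chartAt E p).map_source hx))) u v w

/-- The curvature on coordinate fields, whose brackets vanish, is `dΓ + Γ ∧ Γ`. Here `*` is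
composition of endomorphisms, the form that `exists_gauge` takes. -/
theorem christoffel_flat [T2Space M] [nabla.ContMDiffCovariantDerivative ∞]
    (hflat : ∀ X Y Z : Π x : M, TangentSpace 𝓘(ℝ, E) x, CMDiff ∞ (T% X) → CMDiff ∞ (T% Y) →
      CMDiff ∞ (T% Z) → ∀ x, nabla (fun y ↦ nabla Z y (Y y)) x (X x) -
        nabla (fun y ↦ nabla Z y (X y)) x (Y x) -
        nabla Z x (VectorField.mlieBracket 𝓘(ℝ, E) X Y x) = 0)
    {z : E} (hz : z ∈ (chartAt E p).target) (u v : E) :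
    fderiv ℝ (christoffel nabla p ∘ (chartAt E p).symm) z u v -
      fderiv ℝ (christoffel nabla p ∘ (chartAt E p).symm) z v u +
      (christoffel nabla p ∘ (chartAt E p).symm) z u *
        (christoffel nabla p ∘ (chartAt E p).symm) z v -
      (christoffel nabla p ∘ (chartAt E p).symm) z v *
        (christoffel nabla p ∘ (chartAt E p).symm) z u = 0 := by
  ext w
  obtain ⟨x, hx, rfl⟩ : ∃ x ∈ (chartAt E p).source, chartAt E p x = z :=
    ⟨_, (chartAt E p).map_target hz, (chartAt E p).right_inv hz⟩
  have hc : ∀ u : E, CMDiff[(chartAt E p).source] ∞ (T% (ofChart p (fun _ : M ↦ u))) :=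
    fun u ↦ contMDiffOn_ofChart contMDiffOn_const
  obtain ⟨X, hX, hXu⟩ := contMDiff_extension (chartAt E p).open_source (hc u) hx
  obtain ⟨Y, hY, hYv⟩ := contMDiff_extension (chartAt E p).open_source (hc v) hx
  obtain ⟨Z, hZ, hZw⟩ := contMDiff_extension (chartAt E p).open_source (hc w) hx
  have h := congrArg (chartL p x) (hflat X Y Z hX hY hZ x)
  have hb : VectorField.mlieBracket 𝓘(ℝ, E) X Y x = 0 := by
    rw [← mlieBracket_ofChart_const hx u v]
    exact Filter.EventuallyEq.mlieBracket_vectorField_eq hXu hYv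
  rw [hb, map_zero, sub_zero, map_sub, map_zero, hXu.self_of_nhds, hYv.self_of_nhds, ofChart,
    ofChart, chartL_connection_connection nabla hx u v w hYv hZw,
    chartL_connection_connection nabla hx v u w hXu hZw] at h
  simp only [Function.comp_apply, (chartAt E p).left_inv hx]
  simp only [sub_apply, add_apply, mul_apply_eq_comp, zero_apply]
  rw [← h]
  abel

/-- `X` and `θ` are mutually inverse trivializations of the tangent bundle over the open set `U`,
parallel with respect to the connection. -/
structure IsParallelFrameOn (U : Set M) (X : F → Π x : M, TangentSpace 𝓘(ℝ, E) x)
    (θ : Π x : M, TangentSpace 𝓘(ℝ, E) x →L[ℝ] F) : Prop where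
  isOpen : IsOpen U
  coframe_frame : ∀ x ∈ U, ∀ w, θ x (X w x) = w
  frame_coframe : ∀ x ∈ U, ∀ v, X (θ x v) x = v
  mdifferentiableAt : ∀ x ∈ U, ∀ w, MDiffAt (T% (X w)) x
  parallel : ∀ x ∈ U, ∀ w, nabla (X w) x = 0
  contMDiffAt_coframe : ∀ x ∈ U, ∀ Y : Π x : M, TangentSpace 𝓘(ℝ, E) x, CMDiffAt ∞ (T% Y) x →
    CMDiffAt ∞ (fun y ↦ θ y (Y y)) x
  mdifferentiableAt_coframe : ∀ x ∈ U, ∀ Y : Π x : M, TangentSpace 𝓘(ℝ, E) x, MDiffAt (T% Y) x →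
    MDiffAt (fun y ↦ θ y (Y y)) x
  mvfderiv_coframe : ∀ x ∈ U, ∀ Y : Π x : M, TangentSpace 𝓘(ℝ, E) x, MDiffAt (T% Y) x →
    ∀ v, d% (fun y ↦ θ y (Y y)) x v = θ x (nabla Y x v)

/-- The frame has components `S w`, parallel because `dS + Γ S = 0`; the coframe is `S⁻¹` applied to
components. -/
theorem exists_isParallelFrameOn [T2Space M] [nabla.ContMDiffCovariantDerivative ∞]
    (hflat : ∀ X Y Z : Π x : M, TangentSpace 𝓘(ℝ, E) x, CMDiff ∞ (T% X) → CMDiff ∞ (T% Y) →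
      CMDiff ∞ (T% Z) → ∀ x, nabla (fun y ↦ nabla Z y (Y y)) x (X x) -
        nabla (fun y ↦ nabla Z y (X y)) x (Y x) -
        nabla Z x (VectorField.mlieBracket 𝓘(ℝ, E) X Y x) = 0) (p : M) :
    ∃ (U : Set M) (X : E → Π x : M, TangentSpace 𝓘(ℝ, E) x)
      (θ : Π x : M, TangentSpace 𝓘(ℝ, E) x →L[ℝ] E), p ∈ U ∧ IsParallelFrameOn nabla U X θ := by
  obtain ⟨S, t, hts, hto, hpt, hS, hSt⟩ := exists_gauge (𝔸 := E →L[ℝ] E)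
    ((chartAt E p).open_target.mem_nhds (mem_chart_target E p)) (contDiffOn_christoffel nabla)
    (fun z hz u v ↦ christoffel_flat nabla hflat hz u v)
  have hU : ∀ x ∈ (chartAt E p).source ∩ chartAt E p ⁻¹' t, x ∈ (chartAt E p).source ∧
      chartAt E p x ∈ t ∧ ContDiffAt ℝ ∞ S (chartAt E p x) := fun x hx ↦
    ⟨hx.1, hx.2, hS.contDiffAt (hto.mem_nhds hx.2)⟩
  have hopen : IsOpen ((chartAt E p).source ∩ chartAt E p ⁻¹' t) :=
    (chartAt E p).isOpen_inter_preimage hto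
  have hinv : ∀ x ∈ (chartAt E p).source ∩ chartAt E p ⁻¹' t,
      ContDiffAt ℝ ∞ (fun z ↦ Ring.inverse (S z)) (chartAt E p x) := fun x hx ↦ by
    obtain ⟨s, hs⟩ := (hSt _ hx.2).1
    have h1 : ContDiffAt ℝ ∞ Ring.inverse (S (chartAt E p x)) := by
      rw [← hs]; exact contDiffAt_ringInverse ℝ s
    exact h1.comp _ (hU x hx).2.2
  have hl : ∀ x ∈ (chartAt E p).source ∩ chartAt E p ⁻¹' t, ∀ w,
      Ring.inverse (S (chartAt E p x)) (S (chartAt E p x) w) = w := fun x hx w ↦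
    congrArg (fun A ↦ A w) (Ring.inverse_mul_cancel _ (hSt _ hx.2).1)
  have hr : ∀ x ∈ (chartAt E p).source ∩ chartAt E p ⁻¹' t, ∀ w,
      S (chartAt E p x) (Ring.inverse (S (chartAt E p x)) w) = w := fun x hx w ↦
    congrArg (fun A ↦ A w) (Ring.mul_inverse_cancel _ (hSt _ hx.2).1)
  have hSd : ∀ x ∈ (chartAt E p).source ∩ chartAt E p ⁻¹' t,
      DifferentiableAt ℝ S (chartAt E p x) := fun x hx ↦
    (hU x hx).2.2.differentiableAt (by simp)
  have hchart : ∀ x ∈ (chartAt E p).source ∩ chartAt E p ⁻¹' t,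
      CMDiffAt ∞ (chartAt E p) x := fun x hx ↦
    contMDiffOn_chart.contMDiffAt ((chartAt E p).open_source.mem_nhds hx.1)
  have hθd : ∀ x ∈ (chartAt E p).source ∩ chartAt E p ⁻¹' t,
      ∀ Y : Π x : M, TangentSpace 𝓘(ℝ, E) x, MDiffAt (T% Y) x →
      MDiffAt (fun y ↦ (Ring.inverse (S (chartAt E p y))) (toChart p Y y)) x := fun x hx Y hY ↦
    (mdifferentiableAt_comp_chartAt hx.1 ((hinv x hx).differentiableAt (by simp))).clm_apply
      ((mdifferentiableAt_toChart_iff hx.1 Y).1 hY)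
  have hXd : ∀ x ∈ (chartAt E p).source ∩ chartAt E p ⁻¹' t, ∀ w,
      MDiffAt (fun y ↦ S (chartAt E p y) w) x := fun x hx w ↦
    mdifferentiableAt_comp_chartAt (k := fun z ↦ S z w) hx.1
      ((hSd x hx).clm_apply (differentiableAt_const w))
  refine ⟨(chartAt E p).source ∩ chartAt E p ⁻¹' t,
    fun w ↦ ofChart p (fun y ↦ S (chartAt E p y) w),
    fun y ↦ (Ring.inverse (S (chartAt E p y))).comp (chartL p y), ⟨mem_chart_source E p, hpt⟩,
    hopen, fun x hx w ↦ ?_, fun x hx v ↦ ?_, fun x hx w ↦ ?_, fun x hx w ↦ ?_, fun x hx Y hY ↦ ?_,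
    fun x hx Y hY ↦ hθd x hx Y hY, fun x hx Y hY v ↦ ?_⟩
  · simp only [ContinuousLinearMap.comp_apply, ofChart, chartL_chartSymmL hx.1, hl x hx]
  · simp only [ContinuousLinearMap.comp_apply, ofChart, hr x hx, chartSymmL_chartL hx.1]
  · rw [mdifferentiableAt_toChart_iff hx.1]
    refine (hXd x hx w).congr_of_eventuallyEq ?_
    filter_upwards [(chartAt E p).open_source.mem_nhds hx.1] with y hy using toChart_ofChart hy _
  · ext1 v
    rw [← chartSymmL_chartL (p := p) hx.1 (nabla _ x v),
      chartL_connection_ofChart nabla hx.1 (hXd x hx w),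
      mvfderiv_comp_chartAt (k := fun z ↦ S z w) hx.1 ((hSd x hx).clm_apply
        (differentiableAt_const w))]
    have h1 : fderiv ℝ (fun z ↦ S z w) (chartAt E p x) (chartL p x v) =
        fderiv ℝ S (chartAt E p x) (chartL p x v) w :=
      congrArg (fun A ↦ A (chartL p x v)) ((ContinuousLinearMap.apply ℝ E w).hasFDerivAt.comp _
        (hSd x hx).hasFDerivAt).fderiv
    rw [h1, (hSt _ hx.2).2]
    simp [(chartAt E p).left_inv hx.1]
  · exact ((hinv x hx).contMDiffAt.comp x (hchart x hx)).clm_apply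
      ((contMDiffAt_toChart_iff hx.1 Y).1 hY)
  · have hg := hθd x hx Y hY
    have hYd := (mdifferentiableAt_toChart_iff hx.1 Y).1 hY
    set g : M → E := fun y ↦ (Ring.inverse (S (chartAt E p y))) (toChart p Y y) with hgdef
    -- Write the components of `Y` as `S g`. In `d(S g) + Γ S g` the terms `dS g` and `Γ S g`
    -- cancel, so `∇Y` has components `S dg`.
    have hYg : toChart p Y ∘ (chartAt E p).symm =ᶠ[𝓝 (chartAt E p x)]
        fun z ↦ S z ((g ∘ (chartAt E p).symm) z) := by
      filter_upwards [(hto.inter (chartAt E p).open_target).mem_nhds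
        ⟨hx.2, (chartAt E p).map_source hx.1⟩] with z hz
      have h3 := hr ((chartAt E p).symm z) ⟨(chartAt E p).map_target hz.2, by
        simpa [(chartAt E p).right_inv hz.2] using hz.1⟩ (toChart p Y ((chartAt E p).symm z))
      rw [(chartAt E p).right_inv hz.2] at h3
      simp only [hgdef, Function.comp_apply, (chartAt E p).right_inv hz.2, h3]
    have h4 := chartL_connection_apply nabla hx.1 hY v
    rw [mvfderiv_eq_fderiv hx.1 hYd, hYg.fderiv_eq, ((hSd x hx).hasFDerivAt.clm_apply
      (differentiableAt_comp_chartAt_symm hx.1 hg).hasFDerivAt).fderiv] at h4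
    have h5 : toChart p Y x = S (chartAt E p x) (g x) := (hr x hx _).symm
    simp only [add_apply, ContinuousLinearMap.comp_apply, ContinuousLinearMap.flip_apply,
      (hSt _ hx.2).2, Function.comp_apply, (chartAt E p).left_inv hx.1, neg_apply,
      mul_apply_eq_comp, h5, neg_add_cancel_right] at h4
    change d% g x v = _
    rw [mvfderiv_eq_fderiv hx.1 hg, ContinuousLinearMap.comp_apply, h4, hl x hx]

end ParallelFrame
end
end SpecialGeometry

/-! ### Symplectic linear algebra; real and imaginary parts of `Ω` and `γ`. -/

namespace SpecialGeometry

noncomputable section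

section StandardForms

variable {n : ℕ}

/-- The standard symplectic form `∑ dx^i ∧ dy_i` on `ℝ^{2n}`. -/
def stdSymp (n : ℕ) : (Fin n ⊕ Fin n → ℝ) →ₗ[ℝ] (Fin n ⊕ Fin n → ℝ) →ₗ[ℝ] ℝ :=
  LinearMap.mk₂ ℝ
    (fun a b ↦ ∑ i, (a (Sum.inl i) * b (Sum.inr i) - a (Sum.inr i) * b (Sum.inl i)))
    (fun a a' b ↦ by
      rw [← Finset.sum_add_distrib]
      exact Finset.sum_congr rfl fun i _ ↦ by simp only [Pi.add_apply]; ring)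
    (fun c a b ↦ by
      rw [smul_eq_mul, Finset.mul_sum]
      exact Finset.sum_congr rfl fun i _ ↦ by simp only [Pi.smul_apply, smul_eq_mul]; ring)
    (fun a b b' ↦ by
      rw [← Finset.sum_add_distrib]
      exact Finset.sum_congr rfl fun i _ ↦ by simp only [Pi.add_apply]; ring)
    (fun c a b ↦ by
      rw [smul_eq_mul, Finset.mul_sum]
      exact Finset.sum_congr rfl fun i _ ↦ by simp only [Pi.smul_apply, smul_eq_mul]; ring)

theorem stdSymp_apply (a b : Fin n ⊕ Fin n → ℝ) : stdSymp n a b =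
    ∑ i, (a (Sum.inl i) * b (Sum.inr i) - a (Sum.inr i) * b (Sum.inl i)) := rfl

theorem stdSymp_eq_dotProduct (a b : Fin n ⊕ Fin n → ℝ) :
    stdSymp n a b = -(a ⬝ᵥ (Matrix.J (Fin n) ℝ).mulVec b) := by
  simp only [stdSymp_apply, Matrix.J, Matrix.mulVec, dotProduct, Fintype.sum_sum_type,
    Matrix.fromBlocks_apply₁₁, Matrix.fromBlocks_apply₁₂, Matrix.fromBlocks_apply₂₁,
    Matrix.fromBlocks_apply₂₂, Matrix.zero_apply, zero_mul, Finset.sum_const_zero, zero_add,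
    add_zero, Matrix.neg_apply, Matrix.one_apply, neg_mul, ite_mul, one_mul, Finset.sum_neg_distrib,
    Finset.sum_ite_eq, Finset.mem_univ, if_true, mul_neg, Finset.sum_sub_distrib]
  ring

/-- Membership means `A J Aᵀ = J`, invariance of the form means `Aᵀ J A = J`; closure of the group
under transposition links the two. -/
theorem mem_symplecticGroup_iff_stdSymp (A : Matrix (Fin n ⊕ Fin n) (Fin n ⊕ Fin n) ℝ) :
    A ∈ Matrix.symplecticGroup (Fin n) ℝ ↔
      ∀ a b, stdSymp n (A.mulVec a) (A.mulVec b) = stdSymp n a b := by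
  have key : ∀ a b : Fin n ⊕ Fin n → ℝ, stdSymp n (A.mulVec a) (A.mulVec b) =
      -(a ⬝ᵥ (A.transpose * Matrix.J (Fin n) ℝ * A).mulVec b) := fun a b ↦ by
    rw [stdSymp_eq_dotProduct, ← Matrix.mulVec_mulVec, ← Matrix.mulVec_mulVec,
      Matrix.dotProduct_mulVec a, Matrix.vecMul_transpose]
  rw [← SymplecticGroup.transpose_mem_iff, SymplecticGroup.mem_iff, Matrix.transpose_transpose]
  simp only [key, stdSymp_eq_dotProduct, neg_inj]
  refine ⟨fun h a b ↦ by rw [h], fun h ↦ ?_⟩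
  ext i j
  simpa using h (Pi.single i 1) (Pi.single j 1)

/-- Symplectic Gram–Schmidt: a hyperbolic pair is added in the `σ`-orthogonal complement of those
already found. The rank `k` is kept below half the dimension so that induction runs inside a fixed
`V`. -/
theorem exists_linearMap_stdSymp {V : Type*} [AddCommGroup V] [Module ℝ V] [FiniteDimensional ℝ V]
    {σ : V →ₗ[ℝ] V →ₗ[ℝ] ℝ} (halt : ∀ v, σ v v = 0) (hnd : ∀ v, (∀ w, σ v w = 0) → v = 0) (k : ℕ)
    (hk : 2 * k ≤ Module.finrank ℝ V) :
    ∃ B : (Fin k ⊕ Fin k → ℝ) →ₗ[ℝ] V, ∀ a b, σ (B a) (B b) = stdSymp k a b := by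
  have hskew : ∀ v w, σ v w = -σ w v := fun v w ↦ by
    have := halt (v + w)
    simp only [map_add, LinearMap.add_apply, halt] at this
    linarith
  induction k with
  | zero => exact ⟨0, fun a b ↦ by simp [stdSymp_apply]⟩
  | succ k ih =>
    obtain ⟨B, hB⟩ := ih (by omega)
    -- Subtracting `B c` makes `v` orthogonal to the range of `B`; the coefficients `c` come from
    -- pairing `v` with the conjugate basis vectors.
    have hproj : ∀ v, ∃ c, ∀ b, σ (v - B c) (B b) = 0 := fun v ↦ by
      refine ⟨Sum.elim (fun i ↦ σ v (B (Pi.single (Sum.inr i) 1)))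
        (fun i ↦ -σ v (B (Pi.single (Sum.inl i) 1))), fun b ↦ ?_⟩
      rw [map_sub, LinearMap.sub_apply, hB, stdSymp_apply]
      have hb : σ v (B b) = ∑ j, b j * σ v (B (Pi.single j 1)) := by
        conv_lhs => rw [pi_eq_sum_univ' b]
        simp only [map_sum, map_smul, smul_eq_mul]
      rw [hb, Fintype.sum_sum_type, ← Finset.sum_add_distrib, ← Finset.sum_sub_distrib]
      simp only [Sum.elim_inl, Sum.elim_inr]
      exact Finset.sum_eq_zero fun i _ ↦ by ring
    -- The range has dimension at most `2k < 2(k + 1) ≤ dim V`.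
    have hrange : ∃ v, v ∉ LinearMap.range B := by
      by_contra! h
      have h1 : LinearMap.range B = ⊤ := eq_top_iff.2 fun v _ ↦ h v
      have h2 := LinearMap.finrank_range_le B
      rw [h1, finrank_top] at h2
      simp at h2
      omega
    obtain ⟨v₀, hv₀⟩ := hrange
    obtain ⟨c, hc⟩ := hproj v₀
    set v := v₀ - B c with hv
    have hv0 : v ≠ 0 := fun h ↦ hv₀ ⟨c, (sub_eq_zero.1 h).symm⟩
    obtain ⟨w₀, hw₀⟩ : ∃ w, σ v w ≠ 0 := by
      by_contra! h
      exact hv0 (hnd v h)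
    obtain ⟨d, hd⟩ := hproj w₀
    set w := (σ v w₀)⁻¹ • (w₀ - B d) with hw
    have hvw : σ v w = 1 := by
      rw [hw, map_smul, map_sub (σ v), hc d, sub_zero, smul_eq_mul, inv_mul_cancel₀ hw₀]
    have hwB : ∀ b, σ w (B b) = 0 := fun b ↦ by
      rw [hw, map_smul, LinearMap.smul_apply, hd, smul_zero]
    refine ⟨B.comp (LinearMap.funLeft ℝ ℝ (Sum.map Fin.succ Fin.succ)) +
      (LinearMap.proj (Sum.inl 0)).smulRight v + (LinearMap.proj (Sum.inr 0)).smulRight w,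
      fun a b ↦ ?_⟩
    simp only [LinearMap.add_apply, LinearMap.comp_apply, LinearMap.smulRight_apply,
      LinearMap.proj_apply, map_add, map_smul, LinearMap.smul_apply, hB, hc, hwB, halt, hvw,
      hskew w v, hskew (B _) v, hskew (B _) w, smul_eq_mul, stdSymp_apply, Fin.sum_univ_succ,
      LinearMap.funLeft_apply, Sum.map_inl, Sum.map_inr]
    ring

theorem exists_linearEquiv_stdSymp {V : Type*} [AddCommGroup V] [Module ℝ V]
    [FiniteDimensional ℝ V] {σ : V →ₗ[ℝ] V →ₗ[ℝ] ℝ} (halt : ∀ v, σ v v = 0)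
    (hnd : ∀ v, (∀ w, σ v w = 0) → v = 0) (hn : Module.finrank ℝ V = 2 * n) :
    ∃ B : (Fin n ⊕ Fin n → ℝ) ≃ₗ[ℝ] V, ∀ a b, σ (B a) (B b) = stdSymp n a b := by
  obtain ⟨B, hB⟩ := exists_linearMap_stdSymp halt hnd n hn.ge
  have hinj : Function.Injective B := by
    rw [injective_iff_map_eq_zero]
    intro a ha
    have h : ∀ b, stdSymp n a b = 0 := fun b ↦ by rw [← hB, ha, map_zero, LinearMap.zero_apply]
    ext j
    rcases j with i | i
    · simpa [stdSymp_apply, Pi.single_apply] using h (Pi.single (Sum.inr i) 1)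
    · simpa [stdSymp_apply, Pi.single_apply] using h (Pi.single (Sum.inl i) 1)
  refine ⟨LinearEquiv.ofInjectiveOfFinrankEq B hinj ?_, fun a b ↦ ?_⟩
  · rw [hn]; simp; ring
  · exact hB a b

variable {ε : ℝ}

theorem stdOmega_re (a b : EpsV ε n) : (stdOmega a b).re =
    stdSymp n (fun j ↦ (a j).re) (fun j ↦ (b j).re) +
      ε * stdSymp n (fun j ↦ (a j).im) (fun j ↦ (b j).im) := by
  have h : ∀ f : Fin n → EpsComplex ε, (∑ i, f i).re = ∑ i, (f i).re := fun f ↦ by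
    exact map_sum (⟨⟨QuadraticAlgebra.re, rfl⟩, fun _ _ ↦ rfl⟩ : EpsComplex ε →+ ℝ) f _
  simp only [stdOmega, h, stdSymp_apply, Finset.mul_sum, ← Finset.sum_add_distrib]
  exact Finset.sum_congr rfl fun i _ ↦ by simp; ring

theorem stdOmega_im (a b : EpsV ε n) : (stdOmega a b).im =
    stdSymp n (fun j ↦ (a j).re) (fun j ↦ (b j).im) +
      stdSymp n (fun j ↦ (a j).im) (fun j ↦ (b j).re) := by
  have h : ∀ f : Fin n → EpsComplex ε, (∑ i, f i).im = ∑ i, (f i).im := fun f ↦ by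
    exact map_sum (⟨⟨QuadraticAlgebra.im, rfl⟩, fun _ _ ↦ rfl⟩ : EpsComplex ε →+ ℝ) f _
  simp only [stdOmega, h, stdSymp_apply, ← Finset.sum_add_distrib]
  exact Finset.sum_congr rfl fun i _ ↦ by simp; ring

theorem stdGamma_re (a b : EpsV ε n) : (stdGamma a b).re =
    ε * (stdSymp n (fun j ↦ (a j).im) (fun j ↦ (b j).re) -
      stdSymp n (fun j ↦ (a j).re) (fun j ↦ (b j).im)) := by
  have h1 : (fun j ↦ (star b j).re) = fun j ↦ (b j).re := by ext j; simp
  have h2 : (fun j ↦ (star b j).im) = -fun j ↦ (b j).im := by ext j; simp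
  simp only [stdGamma, epsI, QuadraticAlgebra.re_mul, stdOmega_im, h1, h2, map_neg]
  ring

end StandardForms
end
end SpecialGeometry

/-! ### Locally constant functions on a manifold. -/

namespace SpecialGeometry

open Metric Filter Bundle
open scoped Topology

noncomputable section

section LocallyConstant

variable {E : Type*} [NormedAddCommGroup E] [NormedSpace ℝ E]
  {M : Type*} [TopologicalSpace M] [ChartedSpace E M] [IsManifold 𝓘(ℝ, E) ∞ M]
  {F : Type*} [NormedAddCommGroup F] [NormedSpace ℝ F] {x : M}

theorem eventually_eq_of_mvfderiv_eq_zero {f : M → F} (hf : ∀ᶠ y in 𝓝 x, MDiffAt f y)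
    (hf' : ∀ᶠ y in 𝓝 x, ∀ v, d% f y v = 0) : ∀ᶠ y in 𝓝 x, f y = f x := by
  have hx := mem_chart_source E x
  have hs : Tendsto (chartAt E x).symm (𝓝 (chartAt E x x)) (𝓝 x) := by
    have := (chartAt E x).continuousAt_symm (mem_chart_target E x)
    rwa [ContinuousAt, (chartAt E x).left_inv hx] at this
  have h : ∀ᶠ z in 𝓝 (chartAt E x x), DifferentiableAt ℝ (f ∘ (chartAt E x).symm) z ∧
      fderiv ℝ (f ∘ (chartAt E x).symm) z = 0 := by
    filter_upwards [hs hf, hs hf', (chartAt E x).open_target.mem_nhds (mem_chart_target E x)]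
      with z h1 h2 hz
    have hz' := (chartAt E x).map_target hz
    have h3 := differentiableAt_comp_chartAt_symm hz' h1
    rw [(chartAt E x).right_inv hz] at h3
    refine ⟨h3, ?_⟩
    ext1 u
    have h4 := h2 (chartSymmL x ((chartAt E x).symm z) u)
    rwa [mvfderiv_eq_fderiv hz' h1, chartL_chartSymmL hz', (chartAt E x).right_inv hz] at h4
  obtain ⟨r, hr, hball⟩ := Metric.eventually_nhds_iff_ball.1 h
  filter_upwards [(chartAt E x).open_source.mem_nhds hx,
    ((chartAt E x).continuousAt hx).preimage_mem_nhds (ball_mem_nhds _ hr)] with y hy hyr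
  have h5 := isOpen_ball.is_const_of_fderiv_eq_zero (isPreconnected_ball)
    (fun z hz ↦ (hball z hz).1.differentiableWithinAt) (fun z hz ↦ (hball z hz).2)
    hyr (mem_ball_self hr)
  simpa [(chartAt E x).left_inv hy, (chartAt E x).left_inv hx] using h5

theorem eq_of_eventually_eq {α β : Type*} [TopologicalSpace α] {f : α → β} {W : Set α}
    (hW : IsPreconnected W) (hf : ∀ x ∈ W, ∀ᶠ y in 𝓝 x, f y = f x) {x y : α} (hx : x ∈ W)
    (hy : y ∈ W) : f x = f y := by
  refine hW.induction₂ (fun x y ↦ f x = f y) (fun x hx ↦ ?_) (fun _ _ _ _ _ _ ↦ Eq.trans)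
    (fun _ _ _ _ ↦ Eq.symm) hx hy
  filter_upwards [mem_nhdsWithin_of_mem_nhds (hf x hx)] with y hy using hy.symm

end LocallyConstant

/-! ### Levi-Civita uniqueness and consequences of the cone condition. -/

section Tensors

variable {n : ℕ} {M : Type*} [TopologicalSpace M]
  [ChartedSpace (EuclideanSpace ℝ (Fin (2 * n))) M] [IsManifold (𝓡 (2 * n)) ∞ M]
  {x : M} {X Y Z : VField n M} {J : EndField n M} {b g : BilinField n M}

theorem SmoothBilinField.mdifferentiableAt (hb : SmoothBilinField b) (hY : VFieldDiffAt Y x)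
    (hZ : VFieldDiffAt Z x) :
    MDifferentiableAt (𝓡 (2 * n)) 𝓘(ℝ, ℝ) (fun y ↦ b y (Y y) (Z y)) x := by
  have : MDifferentiableAt (𝓡 (2 * n)) ((𝓡 (2 * n)).prod 𝓘(ℝ))
      (fun m ↦ TotalSpace.mk' ℝ (E := Bundle.Trivial M ℝ) m (b m (Y m) (Z m))) x := by
    apply MDifferentiableAt.clm_bundle_apply₂ (F₁ := EuclideanSpace ℝ (Fin (2 * n)))
      (F₂ := EuclideanSpace ℝ (Fin (2 * n)))
    · exact (hb x).mdifferentiableAt (by simp)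
    · exact hY
    · exact hZ
  simp only [mdifferentiableAt_totalSpace] at this
  exact this.2

theorem SmoothEndField.mdifferentiableAt (hJ : SmoothEndField J) (hY : VFieldDiffAt Y x) :
    VFieldDiffAt (fun y ↦ J y (Y y)) x := by
  apply MDifferentiableAt.clm_bundle_apply (F₁ := EuclideanSpace ℝ (Fin (2 * n)))
    (F₂ := EuclideanSpace ℝ (Fin (2 * n)))
  · exact (hJ x).mdifferentiableAt (by simp)
  · exact hY

theorem SmoothEndField.smoothVField (hJ : SmoothEndField J) (hY : SmoothVField Y) :
    SmoothVField (fun y ↦ J y (Y y)) := fun x ↦ by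
  apply ContMDiffAt.clm_bundle_apply (F₁ := EuclideanSpace ℝ (Fin (2 * n)))
    (F₂ := EuclideanSpace ℝ (Fin (2 * n)))
  · exact hJ x
  · exact hY x

theorem SmoothVField.vFieldDiffAt (hY : SmoothVField Y) (x : M) : VFieldDiffAt Y x :=
  (hY x).mdifferentiableAt (by simp)

theorem exists_vFieldDiffAt (v : TangentSpace (𝓡 (2 * n)) x) :
    ∃ Y : VField n M, VFieldDiffAt Y x ∧ Y x = v :=
  ⟨FiberBundle.extend (EuclideanSpace ℝ (Fin (2 * n))) v,
    FiberBundle.mdifferentiableAt_extend .., FiberBundle.extend_apply_self ..⟩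

theorem connection_sub_connection {D : Connection n M} (hD : D.torsion = 0)
    (hX : VFieldDiffAt X x) (hY : VFieldDiffAt Y x) :
    D Y x (X x) - D X x (Y x) = VectorField.mlieBracket (𝓡 (2 * n)) X Y x := by
  have h := D.torsion_eq_zero_iff.1 hD hX hY
  exact h

/-- The difference tensor is symmetric in its two vector arguments, and after lowering an index it
is skew in the last two; alternating these symmetries gives its own negative. This identifies the
connection making `J` parallel with the one for which `Dξ = Id`. -/
theorem IsLeviCivita.unique (hg : IsPseudoRiemannian g) {D D' : Connection n M}
    (hD : IsLeviCivita g D) (hD' : IsLeviCivita g D') (hY : VFieldDiffAt Y x)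
    (v : TangentSpace (𝓡 (2 * n)) x) : D Y x v = D' Y x v := by
  have hsymm : ∀ {X Y : VField n M}, VFieldDiffAt X x → VFieldDiffAt Y x →
      D Y x (X x) - D' Y x (X x) = D X x (Y x) - D' X x (Y x) := fun {X Y} hX hY ↦ by
    have h1 := connection_sub_connection hD.torsion_free hX hY
    rw [← connection_sub_connection hD'.torsion_free hX hY] at h1
    rw [sub_eq_sub_iff_sub_eq_sub, h1]
  have hskew : ∀ {Y Z : VField n M}, VFieldDiffAt Y x → VFieldDiffAt Z x → ∀ v,
      g x (D Y x v - D' Y x v) (Z x) = -g x (D Z x v - D' Z x v) (Y x) := fun {Y Z} hY hZ v ↦ by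
    have h1 : (_ : ℝ) = _ := (hD.metric x Y Z hY hZ v).symm.trans (hD'.metric x Y Z hY hZ v)
    rw [hg.symm x (Y x) (D Z x v), hg.symm x (Y x) (D' Z x v)] at h1
    have h2 : ∀ u u' w : TangentSpace (𝓡 (2 * n)) x, g x (u - u') w = g x u w - g x u' w :=
      fun u u' w ↦ by rw [map_sub]; rfl
    rw [h2, h2]
    linarith
  rw [← sub_eq_zero]
  refine hg.nondegenerate x _ fun w ↦ ?_
  obtain ⟨X, hX, rfl⟩ := exists_vFieldDiffAt v
  obtain ⟨Z, hZ, rfl⟩ := exists_vFieldDiffAt w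
  have h1 := hskew hY hZ (X x)
  rw [hsymm hX hZ, hskew hX hY, ← hsymm hY hZ, neg_neg] at h1
  have h2 := hskew hZ hX (Y x)
  rw [hsymm hY hX] at h2
  linarith

variable {ε : ℝ} {nabla : Connection n M} {ξ : VField n M}

/-- Zero torsion gives `∇_ξ Y = [ξ, Y] + ∇_Y ξ = [ξ, Y] + Y`, and the same for `D`. Hence `∇_ξ J =
D_ξ J = 0`. -/
theorem IsConicalAffineSpecialEpsKahler.connection_apply_xi
    (hM : IsConicalAffineSpecialEpsKahler ε J g nabla ξ)
    (hY : VFieldDiffAt Y x) : covDerivEnd nabla J Y x (ξ x) = 0 := by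
  obtain ⟨D, hD, hDJ⟩ := hM.affineSpecial.epsKahler.parallel
  obtain ⟨D', hD', hDξ⟩ := hM.leviCivita_eq_id
  have hξ := hM.smooth.vFieldDiffAt x
  have key : ∀ {Y : VField n M}, VFieldDiffAt Y x → nabla Y x (ξ x) = D Y x (ξ x) :=
    fun {Y} hY ↦ by
      have h := connection_sub_connection hM.affineSpecial.torsion_free hξ hY
      rw [← connection_sub_connection hD'.torsion_free hξ hY, hM.nabla_eq_id, hDξ,
        sub_left_inj] at h
      rw [h, hD.unique hM.affineSpecial.epsKahler.metric hD' hY]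
  have h := hDJ x Y hY (ξ x)
  rwa [covDerivEnd, ← key hY,
    ← key (hM.affineSpecial.epsKahler.smooth.mdifferentiableAt hY)] at h

/-- By the special condition `(∇_v J) ξ = (∇_ξ J) v = 0`, so `J` passes through `∇ξ = Id`. This
supplies the primitive for the imaginary part of `φ`. -/
theorem IsConicalAffineSpecialEpsKahler.connection_J_xi
    (hM : IsConicalAffineSpecialEpsKahler ε J g nabla ξ) (v : TangentSpace (𝓡 (2 * n)) x) :
    nabla (fun y ↦ J y (ξ y)) x v = J x v := by
  obtain ⟨X, hX, rfl⟩ := exists_vFieldDiffAt v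
  have h := hM.affineSpecial.special x X ξ hX (hM.smooth.vFieldDiffAt x)
  rw [hM.connection_apply_xi hX, covDerivEnd, hM.nabla_eq_id, sub_eq_zero] at h
  exact h

omit [IsManifold (𝓡 (2 * n)) ∞ M] in
theorem kahlerForm_apply (v w : TangentSpace (𝓡 (2 * n)) x) :
    kahlerForm ε J g x v w = ε * g x (J x v) w := rfl

theorem IsEpsKahler.kahlerForm_self (hK : IsEpsKahler ε J g) (v : TangentSpace (𝓡 (2 * n)) x) :
    kahlerForm ε J g x v v = 0 := by
  have h := hK.skew x v v
  rw [hK.metric.symm x v] at h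
  rw [kahlerForm_apply, show g x (J x v) v = 0 by linarith, mul_zero]

theorem IsEpsKahler.kahlerForm_J (hK : IsEpsKahler ε J g) (hε : ε = -1 ∨ ε = 1)
    (v w : TangentSpace (𝓡 (2 * n)) x) : kahlerForm ε J g x (J x v) w = g x v w := by
  rw [kahlerForm_apply, hK.sq, map_smul, smul_apply, smul_eq_mul, ← mul_assoc]
  rcases hε with rfl | rfl <;> norm_num

theorem IsEpsKahler.kahlerForm_nondegenerate (hK : IsEpsKahler ε J g) (hε : ε = -1 ∨ ε = 1)
    (v : TangentSpace (𝓡 (2 * n)) x) (h : ∀ w, kahlerForm ε J g x v w = 0) : v = 0 := by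
  refine hK.metric.nondegenerate x v fun w ↦ ?_
  have h1 := h (J x w)
  have h2 := hK.skew x v (J x w)
  rw [hK.sq, map_smul, smul_eq_mul] at h2
  rw [kahlerForm_apply, h2] at h1
  rcases hε with rfl | rfl <;> linarith

theorem IsEpsKahler.mdifferentiableAt_kahlerForm (hK : IsEpsKahler ε J g) (hY : VFieldDiffAt Y x)
    (hZ : VFieldDiffAt Z x) :
    MDifferentiableAt (𝓡 (2 * n)) 𝓘(ℝ, ℝ) (fun y ↦ kahlerForm ε J g y (Y y) (Z y)) x :=
  (mdifferentiableAt_const (c := ε)).mul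
    (hK.metric.smooth.mdifferentiableAt (hK.smooth.mdifferentiableAt hY) hZ)

end Tensors
end
end SpecialGeometry

/-! ### Coordinates from the inverse function theorem. -/

namespace SpecialGeometry

open Metric Filter Bundle
open scoped Topology

noncomputable section

section Coordinates

variable {E : Type*} [NormedAddCommGroup E] [NormedSpace ℝ E] [CompleteSpace E]
  {M : Type*} [TopologicalSpace M] [ChartedSpace E M] [IsManifold 𝓘(ℝ, E) ∞ M]
  {F : Type*} [NormedAddCommGroup F] [NormedSpace ℝ F] [CompleteSpace F] {p : M}

/-- The inverse function theorem in a chart, followed by shrinking to a connected open set.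
Smoothness of the inverse is checked at each point, from bijectivity of the differential there. -/
theorem exists_openPartialHomeomorph [LocallyConnectedSpace M] {q₀ : M → F} {U : Set M}
    (hU : IsOpen U) (hp : p ∈ U) (hq : CMDiff[U] ∞ q₀)
    (hd : ∀ x ∈ U, Function.Bijective (d% q₀ x)) :
    ∃ q : OpenPartialHomeomorph M F, p ∈ q.source ∧ IsConnected q.source ∧ q.source ⊆ U ∧
      (∀ x ∈ q.source, q x = q₀ x) ∧ CMDiff[q.source] ∞ q ∧ CMDiff[q.target] ∞ q.symm := by
  set c := chartAt E p with hc
  set h : E → F := q₀ ∘ c.symm with hh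
  have hh1 : ∀ x ∈ U ∩ c.source, ContDiffAt ℝ ∞ h (c x) := fun x hx ↦ by
    rw [← contMDiffAt_iff_contDiffAt]
    refine ContMDiffAt.comp (I' := 𝓘(ℝ, E)) _ ?_ (contMDiffOn_chart_symm.contMDiffAt
      (c.open_target.mem_nhds (c.map_source hx.2)))
    rw [c.left_inv hx.2]
    exact hq.contMDiffAt (hU.mem_nhds hx.1)
  have hh2 : ∀ x ∈ U ∩ c.source, ∃ f : E ≃L[ℝ] F, HasFDerivAt h (f : E →L[ℝ] F) (c x) :=
    fun x hx ↦ by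
      have hmd : MDiffAt q₀ x := (hq.contMDiffAt (hU.mem_nhds hx.1)).mdifferentiableAt (by simp)
      have hb : Function.Bijective (fderiv ℝ h (c x)) := by
        have h1 : ∀ u, fderiv ℝ h (c x) u = d% q₀ x (chartSymmL p x u) := fun u ↦ by
          rw [mvfderiv_eq_fderiv hx.2 hmd, chartL_chartSymmL hx.2]
        refine ⟨fun u u' huu ↦ ?_, fun w ↦ ?_⟩
        · rw [h1, h1] at huu
          rw [← chartL_chartSymmL hx.2 u, (hd x hx.1).1 huu, chartL_chartSymmL hx.2]
        · obtain ⟨v, hv⟩ := (hd x hx.1).2 w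
          exact ⟨chartL p x v, by rw [h1, chartSymmL_chartL hx.2, hv]⟩
      refine ⟨ContinuousLinearEquiv.ofBijective (fderiv ℝ h (c x))
        (LinearMap.ker_eq_bot.2 hb.1) (LinearMap.range_eq_top.2 hb.2), ?_⟩
      rw [ContinuousLinearEquiv.coe_ofBijective]
      exact ((hh1 x hx).differentiableAt (by simp)).hasFDerivAt
  have hpU : p ∈ U ∩ c.source := ⟨hp, mem_chart_source E p⟩
  obtain ⟨f, hf⟩ := hh2 p hpU
  set h' := (hh1 p hpU).toOpenPartialHomeomorph h hf (by simp) with hh'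
  have hh'c : ∀ z, h' z = h z := fun z ↦ rfl
  have hph : c p ∈ h'.source := (hh1 p hpU).mem_toOpenPartialHomeomorph_source hf (by simp)
  have hpW : p ∈ (c.trans h').source ∩ U := ⟨by simp [hpU.2, hph], hp⟩
  obtain ⟨W, hWs, hWo, hpW', hWc⟩ := locallyConnectedSpace_iff_subsets_isOpen_isConnected.1
    inferInstance p _ (((c.trans h').open_source.inter hU).mem_nhds hpW)
  have hsrc : ((c.trans h').restrOpen W hWo).source = W := by
    rw [OpenPartialHomeomorph.restrOpen_source]
    exact inter_eq_right.2 fun x hx ↦ (hWs hx).1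
  have hcsrc : ∀ x ∈ W, x ∈ c.source ∧ c x ∈ h'.source ∧ x ∈ U := fun x hx ↦ by
    have := hWs hx
    simp only [OpenPartialHomeomorph.trans_source, mem_inter_iff, mem_preimage] at this
    exact ⟨this.1.1, this.1.2, this.2⟩
  have heq : ∀ x ∈ W, (c.trans h').restrOpen W hWo x = q₀ x := fun x hx ↦ by
    change q₀ (c.symm (c x)) = _
    rw [c.left_inv (hcsrc x hx).1]
  refine ⟨(c.trans h').restrOpen W hWo, by rwa [hsrc], by rwa [hsrc], ?_, ?_, ?_, ?_⟩
  · rw [hsrc]; exact fun x hx ↦ (hWs hx).2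
  · rwa [hsrc]
  · rw [hsrc]
    exact (hq.mono fun x hx ↦ (hWs hx).2).congr heq
  · intro y hy
    set x := ((c.trans h').restrOpen W hWo).symm y with hx
    have hxW : x ∈ W := hsrc ▸ ((c.trans h').restrOpen W hWo).map_target hy
    have hyt : y ∈ h'.target := by
      have := ((c.trans h').restrOpen W hWo).right_inv hy
      rw [← this]
      exact h'.map_source (hcsrc x hxW).2.1
    have hyx : h'.symm y = c x := by
      have := ((c.trans h').restrOpen W hWo).right_inv hy
      rw [← this]
      exact h'.left_inv (hcsrc x hxW).2.1
    have hxU : x ∈ U ∩ c.source := ⟨(hcsrc x hxW).2.2, (hcsrc x hxW).1⟩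
    obtain ⟨f', hf'⟩ := hh2 x hxU
    have h1 : ContDiffAt ℝ ∞ h'.symm y := h'.contDiffAt_symm (f₀' := f') hyt
      (by rw [hyx]; exact hf') (by rw [hyx]; exact hh1 x hxU)
    refine ContMDiffAt.contMDiffWithinAt ?_
    change CMDiffAt ∞ (c.symm ∘ h'.symm) y
    refine ContMDiffAt.comp (I' := 𝓘(ℝ, E)) y ?_ h1.contMDiffAt
    rw [hyx]
    exact contMDiffOn_chart_symm.contMDiffAt (c.open_target.mem_nhds (c.map_source hxU.2))

end Coordinates
end
end SpecialGeometry

/-! ### Parallel frames under linear maps, and symplectic parallel frames. -/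

namespace SpecialGeometry

open Metric Filter Bundle
open scoped Topology

noncomputable section

section Frames

variable {E : Type*} [NormedAddCommGroup E] [NormedSpace ℝ E]
  {M : Type*} [TopologicalSpace M] [ChartedSpace E M]
  {F : Type*} [NormedAddCommGroup F] [NormedSpace ℝ F]
  {G : Type*} [NormedAddCommGroup G] [NormedSpace ℝ G] {x : M}

theorem mdifferentiableAt_clm_comp (L : F →L[ℝ] G) {f : M → F} (hf : MDiffAt f x) :
    MDiffAt (fun y ↦ L (f y)) x :=
  L.differentiableAt.mdifferentiableAt.comp x hf

theorem mvfderiv_clm_comp (L : F →L[ℝ] G) {f : M → F} (hf : MDiffAt f x)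
    (v : TangentSpace 𝓘(ℝ, E) x) : d% (fun y ↦ L (f y)) x v = L (d% f x v) := by
  have h := mfderiv_comp_apply x (I' := 𝓘(ℝ, F)) (g := L) L.differentiableAt.mdifferentiableAt hf v
  rw [mfderiv_eq_fderiv, L.fderiv] at h
  exact h

variable [IsManifold 𝓘(ℝ, E) ∞ M]
  {nabla : CovariantDerivative 𝓘(ℝ, E) E (TangentSpace 𝓘(ℝ, E) : M → Type _)}
  {U V : Set M} {X : F → Π x : M, TangentSpace 𝓘(ℝ, E) x}
  {θ : Π x : M, TangentSpace 𝓘(ℝ, E) x →L[ℝ] F}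

theorem IsParallelFrameOn.mono (h : IsParallelFrameOn nabla U X θ) (hV : IsOpen V) (hVU : V ⊆ U) :
    IsParallelFrameOn nabla V X θ where
  isOpen := hV
  coframe_frame x hx := h.coframe_frame x (hVU hx)
  frame_coframe x hx := h.frame_coframe x (hVU hx)
  mdifferentiableAt x hx := h.mdifferentiableAt x (hVU hx)
  parallel x hx := h.parallel x (hVU hx)
  contMDiffAt_coframe x hx := h.contMDiffAt_coframe x (hVU hx)
  mdifferentiableAt_coframe x hx := h.mdifferentiableAt_coframe x (hVU hx)
  mvfderiv_coframe x hx := h.mvfderiv_coframe x (hVU hx)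

theorem IsParallelFrameOn.comp_equiv (h : IsParallelFrameOn nabla U X θ) (C : G ≃L[ℝ] F) :
    IsParallelFrameOn nabla U (fun a ↦ X (C a)) (fun x ↦ (C.symm : F →L[ℝ] G).comp (θ x)) where
  isOpen := h.isOpen
  coframe_frame x hx a := by
    rw [ContinuousLinearMap.comp_apply, h.coframe_frame x hx]
    exact C.symm_apply_apply a
  frame_coframe x hx v := by
    rw [ContinuousLinearMap.comp_apply]
    exact (congrArg (fun w ↦ X w x) (C.apply_symm_apply _)).trans (h.frame_coframe x hx v)
  mdifferentiableAt x hx a := h.mdifferentiableAt x hx (C a)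
  parallel x hx a := h.parallel x hx (C a)
  contMDiffAt_coframe x hx Y hY :=
    (C.symm : F →L[ℝ] G).contDiff.contMDiff.contMDiffAt.comp x (h.contMDiffAt_coframe x hx Y hY)
  mdifferentiableAt_coframe x hx Y hY :=
    mdifferentiableAt_clm_comp (C.symm : F →L[ℝ] G) (h.mdifferentiableAt_coframe x hx Y hY)
  mvfderiv_coframe x hx Y hY v := by
    refine (mvfderiv_clm_comp (C.symm : F →L[ℝ] G)
      (h.mdifferentiableAt_coframe x hx Y hY) v).trans ?_
    rw [h.mvfderiv_coframe x hx Y hY]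
    rfl

theorem IsParallelFrameOn.bijective (h : IsParallelFrameOn nabla U X θ) (hx : x ∈ U) :
    Function.Bijective (θ x) :=
  ⟨fun v v' hv ↦ by rw [← h.frame_coframe x hx v, hv, h.frame_coframe x hx],
    fun w ↦ ⟨X w x, h.coframe_frame x hx w⟩⟩

end Frames

section SymplecticFrame

variable {n : ℕ} {M : Type*} [TopologicalSpace M]
  [ChartedSpace (EuclideanSpace ℝ (Fin (2 * n))) M] [IsManifold (𝓡 (2 * n)) ∞ M]
  {x : M} {ε : ℝ} {J : EndField n M} {g : BilinField n M} {nabla : Connection n M}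

instance (x : M) : FiniteDimensional ℝ (TangentSpace (𝓡 (2 * n)) x) :=
  inferInstanceAs (FiniteDimensional ℝ (EuclideanSpace ℝ (Fin (2 * n))))

/-- The factor 2 is the one forced by `g = Re φ^*γ` for a Lagrangian `φ`; see
`IsKahlerianLagrangianImmersionOn.kahlerForm_eq`. -/
theorem IsEpsKahler.exists_linearEquiv_stdSymp (hK : IsEpsKahler ε J g) (hε : ε = -1 ∨ ε = 1)
    (x : M) : ∃ B : (Fin n ⊕ Fin n → ℝ) ≃ₗ[ℝ] TangentSpace (𝓡 (2 * n)) x,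
      ∀ a b, kahlerForm ε J g x (B a) (B b) = 2 * stdSymp n a b := by
  let σ : TangentSpace (𝓡 (2 * n)) x →ₗ[ℝ] TangentSpace (𝓡 (2 * n)) x →ₗ[ℝ] ℝ :=
    LinearMap.mk₂ ℝ (fun v w ↦ kahlerForm ε J g x v w / 2)
      (fun v v' w ↦ by rw [map_add, add_apply, add_div])
      (fun c v w ↦ by rw [map_smul, smul_apply, smul_eq_mul, smul_eq_mul, mul_div_assoc])
      (fun v w w' ↦ by rw [map_add, add_div])
      (fun c v w ↦ by rw [map_smul, smul_eq_mul, smul_eq_mul, mul_div_assoc])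
  have hσ : ∀ v w, σ v w = kahlerForm ε J g x v w / 2 := fun v w ↦ rfl
  obtain ⟨B, hB⟩ := SpecialGeometry.exists_linearEquiv_stdSymp (n := n) (σ := σ)
    (fun v ↦ by rw [hσ, hK.kahlerForm_self, zero_div])
    (fun v hv ↦ hK.kahlerForm_nondegenerate hε v fun w ↦ by have := hv w; rw [hσ] at this; linarith)
    (finrank_euclideanSpace_fin (𝕜 := ℝ) (n := 2 * n))
  exact ⟨B, fun a b ↦ by rw [← hB, hσ]; ring⟩

/-- Because `∇ω = 0`, the coefficients of `ω` in a parallel frame are constant on a connected set;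
normalizing them at `p` normalizes them everywhere. -/
theorem IsAffineSpecialEpsKahler.exists_symplectic_frame [T2Space M]
    (hM : IsAffineSpecialEpsKahler ε J g nabla) (hε : ε = -1 ∨ ε = 1) (p : M) :
    ∃ (U : Set M) (X : (Fin n ⊕ Fin n → ℝ) → VField n M)
      (θ : Π x : M, TangentSpace (𝓡 (2 * n)) x →L[ℝ] (Fin n ⊕ Fin n → ℝ)),
      p ∈ U ∧ IsParallelFrameOn nabla U X θ ∧ ∀ y ∈ U, ∀ v w,
        kahlerForm ε J g y v w = 2 * stdSymp n (θ y v) (θ y w) := by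
  have := hM.smooth
  have : LocallyConnectedSpace M :=
    ChartedSpace.locallyConnectedSpace (EuclideanSpace ℝ (Fin (2 * n))) M
  obtain ⟨U, X, θ, hpU, h⟩ := exists_isParallelFrameOn nabla hM.flat p
  obtain ⟨W, hWU, hWo, hpW, hWc⟩ := locallyConnectedSpace_iff_subsets_isOpen_isConnected.1
    inferInstance p U (h.isOpen.mem_nhds hpU)
  replace h := h.mono hWo hWU
  have hconst : ∀ a b, ∀ y ∈ W, kahlerForm ε J g y (X a y) (X b y) =
      kahlerForm ε J g p (X a p) (X b p) := fun a b y hy ↦ by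
    refine eq_of_eventually_eq (f := fun y ↦ kahlerForm ε J g y (X a y) (X b y))
      hWc.isPreconnected (fun x hx ↦ ?_) hy hpW
    refine eventually_eq_of_mvfderiv_eq_zero (E := EuclideanSpace ℝ (Fin (2 * n))) ?_ ?_
    · filter_upwards [hWo.mem_nhds hx] with y hy
      exact hM.epsKahler.mdifferentiableAt_kahlerForm (h.mdifferentiableAt y hy a)
        (h.mdifferentiableAt y hy b)
    · filter_upwards [hWo.mem_nhds hx] with y hy v
      refine (hM.symplectic y (X a) (X b) (h.mdifferentiableAt y hy a)
        (h.mdifferentiableAt y hy b) v).trans ?_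
      rw [h.parallel y hy, h.parallel y hy]
      simp
      rfl
  obtain ⟨B, hB⟩ := hM.epsKahler.exists_linearEquiv_stdSymp hε p
  -- A constant change of frame, under which the frame at `p` becomes the symplectic basis `B`.
  let C : (Fin n ⊕ Fin n → ℝ) ≃L[ℝ] EuclideanSpace ℝ (Fin (2 * n)) :=
    (B.trans (LinearEquiv.ofBijective (θ p).toLinearMap (h.bijective hpW))).toContinuousLinearEquiv
  have hC : ∀ a, C a = θ p (B a) := fun a ↦ rfl
  have h' := h.comp_equiv C
  refine ⟨W, _, _, hpW, h', fun y hy v w ↦ ?_⟩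
  obtain ⟨a, rfl⟩ : ∃ a, X (C a) y = v := ⟨_, h'.frame_coframe y hy v⟩
  obtain ⟨b, rfl⟩ : ∃ b, X (C b) y = w := ⟨_, h'.frame_coframe y hy w⟩
  rw [hconst _ _ y hy, h'.coframe_frame y hy, h'.coframe_frame y hy, hC, hC,
    h.frame_coframe p hpW, h.frame_coframe p hpW, hB]

end SymplecticFrame
end
end SpecialGeometry

/-! ### Existence of conical special affine coordinates. -/

namespace SpecialGeometry

open Metric Filter Bundle
open scoped Topology

noncomputable section

variable {n : ℕ} {M : Type*} [TopologicalSpace M]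
  [ChartedSpace (EuclideanSpace ℝ (Fin (2 * n))) M]
  {x : M} {ε : ℝ} {J : EndField n M} {g : BilinField n M}

instance (x : M) : T2Space (TangentSpace (𝓡 (2 * n)) x) :=
  inferInstanceAs (T2Space (EuclideanSpace ℝ (Fin (2 * n))))

theorem isInvertible_of_bijective
    {L : TangentSpace (𝓡 (2 * n)) x →L[ℝ] (Fin n ⊕ Fin n → ℝ)} (hL : Function.Bijective L) :
    L.IsInvertible :=
  ⟨(LinearEquiv.ofBijective L.toLinearMap hL).toContinuousLinearEquiv, rfl⟩

theorem bijective_of_injective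
    {L : TangentSpace (𝓡 (2 * n)) x →L[ℝ] (Fin n ⊕ Fin n → ℝ)} (hL : Function.Injective L) :
    Function.Bijective L := by
  refine ⟨hL, (LinearMap.injective_iff_surjective_of_finrank_eq_finrank
    (f := L.toLinearMap) ?_).1 hL⟩
  refine (finrank_euclideanSpace_fin (𝕜 := ℝ) (n := 2 * n)).trans ?_
  simp [two_mul]

theorem coordField_eq {q : OpenPartialHomeomorph M (Fin n ⊕ Fin n → ℝ)} {a : Fin n ⊕ Fin n}
    {v : TangentSpace (𝓡 (2 * n)) x} (hq : Function.Bijective (mvfderiv (𝓡 (2 * n)) q x))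
    (hv : mvfderiv (𝓡 (2 * n)) q x v = Pi.single a 1) : coordField q a x = v :=
  (isInvertible_of_bijective hq).inverse_apply_eq.2 hv.symm

theorem mfderiv_apply_pi {f : M → Fin n ⊕ Fin n → ℝ}
    (hf : MDifferentiableAt (𝓡 (2 * n)) 𝓘(ℝ, Fin n ⊕ Fin n → ℝ) f x) (a : Fin n ⊕ Fin n)
    (v : TangentSpace (𝓡 (2 * n)) x) :
    mfderiv (𝓡 (2 * n)) 𝓘(ℝ, ℝ) (fun y ↦ f y a) x v = (mvfderiv (𝓡 (2 * n)) f x v) a :=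
  mvfderiv_clm_comp (ContinuousLinearMap.proj a : (Fin n ⊕ Fin n → ℝ) →L[ℝ] ℝ) hf v

theorem epsDeriv_eq {φ : M → EpsV ε n} {r s : M → Fin n ⊕ Fin n → ℝ}
    (hr : ∀ᶠ y in 𝓝 x, ∀ a, (φ y a).re = r y a) (hs : ∀ᶠ y in 𝓝 x, ∀ a, (φ y a).im = s y a)
    (hrd : MDifferentiableAt (𝓡 (2 * n)) 𝓘(ℝ, Fin n ⊕ Fin n → ℝ) r x)
    (hsd : MDifferentiableAt (𝓡 (2 * n)) 𝓘(ℝ, Fin n ⊕ Fin n → ℝ) s x)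
    (v : TangentSpace (𝓡 (2 * n)) x) :
    epsDeriv φ x v = fun a ↦ ⟨(mvfderiv (𝓡 (2 * n)) r x v) a, (mvfderiv (𝓡 (2 * n)) s x v) a⟩ := by
  funext a
  have h1 : (fun y ↦ (φ y a).re) =ᶠ[𝓝 x] fun y ↦ r y a := hr.mono fun y hy ↦ hy a
  have h2 : (fun y ↦ (φ y a).im) =ᶠ[𝓝 x] fun y ↦ s y a := hs.mono fun y hy ↦ hy a
  simp only [epsDeriv, h1.mfderiv_eq, h2.mfderiv_eq]
  rw [← mfderiv_apply_pi hrd, ← mfderiv_apply_pi hsd]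
  rfl

section Existence

variable [IsManifold (𝓡 (2 * n)) ∞ M] {nabla : Connection n M} {ξ : VField n M}

theorem IsConicalAffineSpecialEpsKahler.exists_coords [T2Space M]
    (hM : IsConicalAffineSpecialEpsKahler ε J g nabla ξ) (hε : ε = -1 ∨ ε = 1) (p : M) :
    ∃ q : OpenPartialHomeomorph M (Fin n ⊕ Fin n → ℝ), p ∈ q.source ∧ IsConnected q.source ∧
      IsConicalSpecialAffineCoords ε J g nabla ξ q := by
  have : LocallyConnectedSpace M :=
    ChartedSpace.locallyConnectedSpace (EuclideanSpace ℝ (Fin (2 * n))) M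
  have hK := hM.affineSpecial.epsKahler
  have hε2 : ε * ε = 1 := by rcases hε with rfl | rfl <;> norm_num
  obtain ⟨U, X, θ, hpU, h, hσ⟩ := hM.affineSpecial.exists_symplectic_frame hε p
  have hξ : ∀ x, VFieldDiffAt ξ x := hM.smooth.vFieldDiffAt
  have hJξ : ∀ x, VFieldDiffAt (fun y ↦ J y (ξ y)) x := fun x ↦ hK.smooth.mdifferentiableAt (hξ x)
  have hd : ∀ x ∈ U, ∀ v, mvfderiv (𝓡 (2 * n)) (fun y ↦ θ y (ξ y)) x v = θ x v := fun x hx v ↦ by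
    rw [h.mvfderiv_coframe x hx ξ (hξ x), hM.nabla_eq_id]
  have hdJ : ∀ x ∈ U, ∀ v,
      mvfderiv (𝓡 (2 * n)) (fun y ↦ ε • θ y (J y (ξ y))) x v = ε • θ x (J x v) :=
    fun x hx v ↦ by
      refine (mvfderiv_clm_comp (ε • ContinuousLinearMap.id ℝ (Fin n ⊕ Fin n → ℝ))
        (h.mdifferentiableAt_coframe x hx _ (hJξ x)) v).trans ?_
      rw [h.mvfderiv_coframe x hx _ (hJξ x), hM.connection_J_xi]
      rfl
  have hbij : ∀ x ∈ U,
      Function.Bijective (mvfderiv (𝓡 (2 * n)) (fun y ↦ θ y (ξ y)) x) := fun x hx ↦ by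
    rw [show (mvfderiv (𝓡 (2 * n)) (fun y ↦ θ y (ξ y)) x :
        TangentSpace (𝓡 (2 * n)) x →L[ℝ] _) = θ x from
      ContinuousLinearMap.ext (hd x hx)]
    exact h.bijective hx
  obtain ⟨q, hpq, hqc, hqU, hq, hqs, hqs'⟩ := exists_openPartialHomeomorph h.isOpen hpU
    (fun x hx ↦ (h.contMDiffAt_coframe x hx ξ (hM.smooth x)).contMDiffWithinAt) hbij
  have hq' : ∀ x ∈ q.source, q =ᶠ[𝓝 x] fun y ↦ θ y (ξ y) := fun x hx ↦ by
    filter_upwards [q.open_source.mem_nhds hx] with y hy using hq y hy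
  have hdq : ∀ x ∈ q.source, ∀ v, mvfderiv (𝓡 (2 * n)) q x v = θ x v := fun x hx v ↦ by
    rw [← hd x (hqU hx), mvfderiv, mvfderiv, (hq' x hx).mfderiv_eq]
    rfl
  have hcf : ∀ x ∈ q.source, ∀ a, coordField q a x = X (Pi.single a 1) x := fun x hx a ↦ by
    refine coordField_eq ?_ ?_
    · rw [show (mvfderiv (𝓡 (2 * n)) q x : TangentSpace (𝓡 (2 * n)) x →L[ℝ] _) = θ x from
        ContinuousLinearMap.ext (hdq x hx)]
      exact h.bijective (hqU hx)
    · rw [hdq x hx, h.coframe_frame x (hqU hx)]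
  -- The real part is `q`. Holomorphy forces the imaginary part to have differential `ε θ ∘ J`, and
  -- `ε θ(Jξ)` is a primitive because `∇(Jξ) = J`.
  set φ : M → EpsV ε n := fun y a ↦ ⟨θ y (ξ y) a, (ε • θ y (J y (ξ y))) a⟩ with hφ
  have hdφ : ∀ x ∈ U, ∀ v, epsDeriv φ x v = fun a ↦ ⟨θ x v a, (ε • θ x (J x v)) a⟩ :=
    fun x hx v ↦ by
      rw [epsDeriv_eq (r := fun y ↦ θ y (ξ y)) (s := fun y ↦ ε • θ y (J y (ξ y)))
        (Eventually.of_forall fun y a ↦ rfl) (Eventually.of_forall fun y a ↦ rfl)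
        (h.mdifferentiableAt_coframe x hx ξ (hξ x))
        (mdifferentiableAt_clm_comp (ε • ContinuousLinearMap.id ℝ (Fin n ⊕ Fin n → ℝ))
          (h.mdifferentiableAt_coframe x hx _ (hJξ x))), hd x hx, hdJ x hx]
  have hωJ : ∀ (x : M) (v w : TangentSpace (𝓡 (2 * n)) x),
      kahlerForm ε J g x v (J x w) = -g x v w := fun x v w ↦ by
    rw [kahlerForm_apply, hK.skew, hK.sq, map_smul, smul_eq_mul]
    linear_combination -g x v w * hε2
  have hgγ : ∀ x ∈ q.source, ∀ v w : TangentSpace (𝓡 (2 * n)) x,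
      g x v w = (stdGamma (epsDeriv φ x v) (epsDeriv φ x w)).re := fun x hx v w ↦ by
    have h1 := hσ x (hqU hx) (J x v) w
    have h2 := hσ x (hqU hx) v (J x w)
    rw [hK.kahlerForm_J hε] at h1
    rw [hωJ] at h2
    rw [hdφ x (hqU hx), hdφ x (hqU hx), stdGamma_re]
    change _ = ε * (stdSymp n (ε • θ x (J x v)) (θ x w) - stdSymp n (θ x v) (ε • θ x (J x w)))
    rw [map_smul, map_smul, LinearMap.smul_apply, smul_eq_mul, smul_eq_mul]
    linear_combination (h1 - h2) / 2 -
      (stdSymp n (θ x (J x v)) (θ x w) - stdSymp n (θ x v) (θ x (J x w))) * hε2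
  refine ⟨q, hpq, hqc, ⟨⟨⟨hqs, hqs'⟩, fun x hx a ↦ ?_⟩, φ, ⟨fun a x hx ↦ ?_, fun a x hx ↦ ?_,
    fun x hx v w hvw ↦ ?_, fun x hx v ↦ ?_, fun x hx v hv ↦ ?_, fun x hx v w ↦ ?_⟩, hgγ,
    fun x hx a ↦ by rw [hq x hx]⟩, fun x hx ↦ ?_⟩
  · rw [connection_congr nabla (h.mdifferentiableAt x (hqU hx) (Pi.single a 1)),
      h.parallel x (hqU hx)]
    filter_upwards [q.open_source.mem_nhds hx] with y hy using hcf y hy a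
  · exact ((ContinuousLinearMap.proj a :
      (Fin n ⊕ Fin n → ℝ) →L[ℝ] ℝ).contDiff.contMDiff.contMDiffAt.comp
      x (h.contMDiffAt_coframe x (hqU hx) ξ (hM.smooth x))).contMDiffWithinAt
  · exact ((ε • ContinuousLinearMap.proj a :
      (Fin n ⊕ Fin n → ℝ) →L[ℝ] ℝ).contDiff.contMDiff.contMDiffAt.comp
      x (h.contMDiffAt_coframe x (hqU hx) _ (hK.smooth.smoothVField hM.smooth x))).contMDiffWithinAt
  · rw [hdφ x (hqU hx), hdφ x (hqU hx)] at hvw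
    exact (h.bijective (hqU hx)).1 (funext fun a ↦ congrArg (fun z ↦ (z a).re) hvw)
  · rw [hdφ x (hqU hx), hdφ x (hqU hx)]
    funext a
    rw [hK.sq, map_smul, smul_smul, hε2, one_smul]
    ext
    · simp [epsI, ← mul_assoc, hε2]
    · simp [epsI]
  · refine hK.metric.nondegenerate x v fun w ↦ ?_
    rw [hgγ x hx, hv]
    rfl
  · rw [hdφ x (hqU hx), hdφ x (hqU hx)]
    have h1 := hσ x (hqU hx) (J x v) w
    have h2 := hσ x (hqU hx) v (J x w)
    have h3 := hσ x (hqU hx) v w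
    have h4 := hσ x (hqU hx) (J x v) (J x w)
    rw [hK.kahlerForm_J hε] at h1 h4
    rw [hωJ] at h2
    rw [kahlerForm_apply, hK.skew] at h3
    ext
    · rw [stdOmega_re]
      change stdSymp n (θ x v) (θ x w) + ε * stdSymp n (ε • θ x (J x v)) (ε • θ x (J x w)) = 0
      rw [map_smul, map_smul, LinearMap.smul_apply, smul_eq_mul, smul_eq_mul]
      linear_combination -h3 / 2 - ε * h4 / 2 +
        ε * stdSymp n (θ x (J x v)) (θ x (J x w)) * hε2
    · rw [stdOmega_im]
      change stdSymp n (θ x v) (ε • θ x (J x w)) + stdSymp n (ε • θ x (J x v)) (θ x w) = 0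
      rw [map_smul, map_smul, LinearMap.smul_apply, smul_eq_mul, smul_eq_mul]
      linear_combination -ε * (h1 + h2) / 2
  · refine (h.bijective (hqU hx)).1 ?_
    rw [map_sum, ← hq x hx]
    simp only [map_smul, hcf x hx, h.coframe_frame x (hqU hx)]
    exact pi_eq_sum_univ' (q x)

end Existence
end
end SpecialGeometry

/-! ### Affine coordinates and uniqueness up to symplectic maps. -/

namespace SpecialGeometry

open Metric Filter Bundle
open scoped Topology

noncomputable section

section AffineCoordinates

variable {n : ℕ} {M : Type*} [TopologicalSpace M]
  [ChartedSpace (EuclideanSpace ℝ (Fin (2 * n))) M] {x : M}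
  {q q' : OpenPartialHomeomorph M (Fin n ⊕ Fin n → ℝ)}

theorem IsSmoothCoords.contMDiffAt (hq : IsSmoothCoords q) (hx : x ∈ q.source) :
    ContMDiffAt (𝓡 (2 * n)) 𝓘(ℝ, Fin n ⊕ Fin n → ℝ) ∞ q x :=
  hq.1.contMDiffAt (q.open_source.mem_nhds hx)

theorem IsSmoothCoords.mdifferentiableAt (hq : IsSmoothCoords q) (hx : x ∈ q.source) :
    MDifferentiableAt (𝓡 (2 * n)) 𝓘(ℝ, Fin n ⊕ Fin n → ℝ) q x :=
  (hq.contMDiffAt hx).mdifferentiableAt (by simp)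

theorem IsSmoothCoords.bijective (hq : IsSmoothCoords q) (hx : x ∈ q.source) :
    Function.Bijective (mvfderiv (𝓡 (2 * n)) q x) := by
  refine bijective_of_injective ?_
  have h1 : MDifferentiableAt 𝓘(ℝ, Fin n ⊕ Fin n → ℝ) (𝓡 (2 * n)) q.symm (q x) :=
    (hq.2.contMDiffAt (q.open_target.mem_nhds (q.map_source hx))).mdifferentiableAt (by simp)
  have h2 := mfderiv_comp x h1 (hq.mdifferentiableAt hx)
  have h3 : q.symm ∘ q =ᶠ[𝓝 x] id := by
    filter_upwards [q.open_source.mem_nhds hx] with y hy using q.left_inv hy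
  rw [h3.mfderiv_eq, mfderiv_id] at h2
  intro v w hvw
  have h4 : ∀ u, u = mfderiv 𝓘(ℝ, Fin n ⊕ Fin n → ℝ) (𝓡 (2 * n)) q.symm (q x)
      (mvfderiv (𝓡 (2 * n)) q x u) := fun u ↦ congrArg (fun L ↦ L u) h2
  rw [h4 v, hvw, ← h4 w]

theorem IsSmoothCoords.mvfderiv_coordField (hq : IsSmoothCoords q) (hx : x ∈ q.source)
    (a : Fin n ⊕ Fin n) : mvfderiv (𝓡 (2 * n)) q x (coordField q a x) = Pi.single a 1 :=
  ((isInvertible_of_bijective (hq.bijective hx)).inverse_apply_eq.1 rfl).symm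

theorem IsSmoothCoords.eq_sum_coordField_iff (hq : IsSmoothCoords q) (hx : x ∈ q.source)
    {v : TangentSpace (𝓡 (2 * n)) x} {c : Fin n ⊕ Fin n → ℝ} :
    v = ∑ a, c a • coordField q a x ↔ mvfderiv (𝓡 (2 * n)) q x v = c := by
  have h : mvfderiv (𝓡 (2 * n)) q x (∑ a, c a • coordField q a x) = c := by
    simp only [map_sum, map_smul, hq.mvfderiv_coordField hx]
    exact (pi_eq_sum_univ' c).symm
  exact ⟨fun hv ↦ by rw [hv, h], fun hv ↦ (hq.bijective hx).1 (by rw [hv, h])⟩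

variable [IsManifold (𝓡 (2 * n)) ∞ M] {nabla : Connection n M}

theorem IsSmoothCoords.vFieldDiffAt_coordField (hq : IsSmoothCoords q) (hx : x ∈ q.source)
    (a : Fin n ⊕ Fin n) : VFieldDiffAt (coordField q a) x := by
  have : IsManifold (𝓡 (2 * n)) 2 M := IsManifold.of_le (n := ∞) (WithTop.coe_le_coe.2 le_top)
  -- A coordinate field is by definition the pullback of a constant field along `q`.
  refine MDifferentiableAt.mpullback_vectorField (I := 𝓡 (2 * n))
    (I' := 𝓘(ℝ, Fin n ⊕ Fin n → ℝ)) (n := ∞)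
    (V := fun _ ↦ (Pi.single a 1 : Fin n ⊕ Fin n → ℝ))
    ((contMDiffAt_vectorSpace_iff_contDiffAt (n := ∞)).2 contDiffAt_const |>.mdifferentiableAt
      (by simp)) (hq.contMDiffAt hx)
    (isInvertible_of_bijective (hq.bijective hx)) (WithTop.coe_le_coe.2 le_top)

theorem connection_sum_smul_eq_zero {ι : Type*} {Y : ι → VField n M}
    (hY : ∀ i, VFieldDiffAt (Y i) x) (h0 : ∀ i, nabla (Y i) x = 0) (c : ι → ℝ) (s : Finset ι) :
    VFieldDiffAt (∑ i ∈ s, c i • Y i) x ∧ nabla (∑ i ∈ s, c i • Y i) x = 0 := by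
  classical
  induction s using Finset.induction_on with
  | empty => exact ⟨mdifferentiableAt_zeroSection .., by
      rw [Finset.sum_empty]; exact nabla.isCovariantDerivativeOn.zero⟩
  | insert i s hi ih =>
    rw [Finset.sum_insert hi]
    have h1 : VFieldDiffAt (c i • Y i) x := mdifferentiableAt_const.smul_section (hY i)
    refine ⟨mdifferentiableAt_add_section h1 ih.1, ?_⟩
    rw [nabla.isCovariantDerivativeOn.add h1 ih.1, ih.2,
      nabla.isCovariantDerivativeOn.smul_const (c i) (hY i), h0, smul_zero, add_zero]

/-- The entries of the Jacobian between two affine systems are locally constant: both systems of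
coordinate fields are parallel, so their components under a parallel coframe `θ` are locally
constant. -/
theorem IsAffineCoords.eventually_mvfderiv_coordField_eq [T2Space M]
    (hflat : IsFlat nabla) (hs : nabla.ContMDiffCovariantDerivative ∞)
    (hq : IsAffineCoords nabla q) (hq' : IsAffineCoords nabla q') (hx : x ∈ q.source)
    (hx' : x ∈ q'.source) (b : Fin n ⊕ Fin n) :
    ∀ᶠ y in 𝓝 x, mvfderiv (𝓡 (2 * n)) q' y (coordField q b y) =
      mvfderiv (𝓡 (2 * n)) q' x (coordField q b x) := by
  obtain ⟨U, X, θ, hxU, h⟩ := exists_isParallelFrameOn nabla hflat x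
  have key : ∀ {q : OpenPartialHomeomorph M (Fin n ⊕ Fin n → ℝ)}, IsAffineCoords nabla q →
      x ∈ q.source → ∀ a, ∀ᶠ y in 𝓝 x, θ y (coordField q a y) = θ x (coordField q a x) :=
    fun {q} hq hx a ↦ by
      have hm := (q.open_source.inter h.isOpen).mem_nhds ⟨hx, hxU⟩
      refine eventually_eq_of_mvfderiv_eq_zero
        (E := EuclideanSpace ℝ (Fin (2 * n))) (f := fun y ↦ θ y (coordField q a y)) ?_ ?_
      · filter_upwards [hm] with y hy
        exact h.mdifferentiableAt_coframe y hy.2 _ (hq.1.vFieldDiffAt_coordField hy.1 a)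
      · filter_upwards [hm] with y hy v
        rw [h.mvfderiv_coframe y hy.2 _ (hq.1.vFieldDiffAt_coordField hy.1 a), hq.2 y hy.1 a,
          zero_apply, map_zero]
  have key' := eventually_all.2 fun a ↦ key hq' hx' a
  filter_upwards [key hq hx b, key', q.open_source.mem_nhds hx, q'.open_source.mem_nhds hx']
    with y h1 h2 hy hy'
  have h3 : ∀ z ∈ q'.source, θ z (coordField q b z) =
      ∑ a, mvfderiv (𝓡 (2 * n)) q' z (coordField q b z) a • θ z (coordField q' a z) :=
    fun z hz ↦ by
      conv_lhs => rw [(hq'.1.eq_sum_coordField_iff hz (v := coordField q b z)).2 rfl]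
      simp only [map_sum, map_smul]
  -- The expansion at `y` becomes, through `θ`, an expansion at `x` with the coefficients of `y`;
  -- injectivity of `θ x` then identifies the coefficients at `x` and `y`.
  have h4 := h3 y hy'
  simp only [h1, h2, ← map_smul, ← map_sum] at h4
  exact ((hq'.1.eq_sum_coordField_iff hx').1 ((h.bijective hxU).1 h4)).symm

end AffineCoordinates

section SpecialCoordinates

variable {n : ℕ} {M : Type*} [TopologicalSpace M]
  [ChartedSpace (EuclideanSpace ℝ (Fin (2 * n))) M] {x : M}
  {ε : ℝ} {J : EndField n M} {g : BilinField n M} {ξ : VField n M} {U : Set M}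
  {q q' : OpenPartialHomeomorph M (Fin n ⊕ Fin n → ℝ)} {φ : M → EpsV ε n}

theorem IsKahlerianLagrangianImmersionOn.mdifferentiableAt_re
    (hφ : IsKahlerianLagrangianImmersionOn J φ U) (hU : IsOpen U) (hx : x ∈ U) :
    MDifferentiableAt (𝓡 (2 * n)) 𝓘(ℝ, Fin n ⊕ Fin n → ℝ) (fun y a ↦ (φ y a).re) x :=
  (contMDiffAt_pi_space.2 fun a ↦
    (hφ.smooth_re a).contMDiffAt (hU.mem_nhds hx)).mdifferentiableAt (by simp)

theorem IsKahlerianLagrangianImmersionOn.mdifferentiableAt_im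
    (hφ : IsKahlerianLagrangianImmersionOn J φ U) (hU : IsOpen U) (hx : x ∈ U) :
    MDifferentiableAt (𝓡 (2 * n)) 𝓘(ℝ, Fin n ⊕ Fin n → ℝ) (fun y a ↦ (φ y a).im) x :=
  (contMDiffAt_pi_space.2 fun a ↦
    (hφ.smooth_im a).contMDiffAt (hU.mem_nhds hx)).mdifferentiableAt (by simp)

/-- Holomorphy turns `ε g(Jv, w)` into a term in real parts minus `ε` times one in imaginary parts.
Since `Re φ^*Ω = 0`, the two contribute equally, whence the factor 2. -/
theorem IsKahlerianLagrangianImmersionOn.kahlerForm_eq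
    (hφ : IsKahlerianLagrangianImmersionOn J φ U) (hε : ε = -1 ∨ ε = 1)
    (hg : ∀ x ∈ U, ∀ v w : TangentSpace (𝓡 (2 * n)) x,
      g x v w = (stdGamma (epsDeriv φ x v) (epsDeriv φ x w)).re) (hx : x ∈ U)
    (v w : TangentSpace (𝓡 (2 * n)) x) :
    kahlerForm ε J g x v w =
      2 * stdSymp n (fun a ↦ (epsDeriv φ x v a).re) (fun a ↦ (epsDeriv φ x w a).re) := by
  have h1 := congrArg QuadraticAlgebra.re (hφ.lagrangian x hx v w)
  have hre : (fun a ↦ (epsI ε * epsDeriv φ x v a).re) = ε • fun a ↦ (epsDeriv φ x v a).im := by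
    funext a; simp [epsI]
  have him : (fun a ↦ (epsI ε * epsDeriv φ x v a).im) = fun a ↦ (epsDeriv φ x v a).re := by
    funext a; simp [epsI]
  have hε2 : ε * ε = 1 := by rcases hε with rfl | rfl <;> norm_num
  rw [kahlerForm_apply, hg x hx, hφ.holomorphic x hx, stdGamma_re, hre, him, map_smul,
    LinearMap.smul_apply, smul_eq_mul]
  rw [stdOmega_re, QuadraticAlgebra.re_zero] at h1
  linear_combination (stdSymp n (fun a ↦ (epsDeriv φ x v a).re) (fun a ↦ (epsDeriv φ x w a).re) -
    ε * stdSymp n (fun a ↦ (epsDeriv φ x v a).im) (fun a ↦ (epsDeriv φ x w a).im)) * hε2 - h1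

variable [IsManifold (𝓡 (2 * n)) ∞ M] {nabla : Connection n M}

theorem IsSpecialAffineCoords.kahlerForm_eq (hq : IsSpecialAffineCoords ε J g nabla q)
    (hε : ε = -1 ∨ ε = 1) (hx : x ∈ q.source) (v w : TangentSpace (𝓡 (2 * n)) x) :
    kahlerForm ε J g x v w =
      2 * stdSymp n (mvfderiv (𝓡 (2 * n)) q x v) (mvfderiv (𝓡 (2 * n)) q x w) := by
  obtain ⟨hqa, φ, hφ, hg, hre⟩ := hq
  have h : ∀ v, (fun a ↦ (epsDeriv φ x v a).re) = mvfderiv (𝓡 (2 * n)) q x v := fun v ↦ by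
    rw [epsDeriv_eq (r := q) (s := fun y a ↦ (φ y a).im) ?_
      (Eventually.of_forall fun y a ↦ rfl) (hqa.1.mdifferentiableAt hx)
      (hφ.mdifferentiableAt_im q.open_source hx)]
    filter_upwards [q.open_source.mem_nhds hx] with y hy a using (hre y hy a).symm
  rw [hφ.kahlerForm_eq hε hg hx, h, h]

theorem IsConicalSpecialAffineCoords.exists_symplectic [T2Space M] (hε : ε = -1 ∨ ε = 1)
    (hflat : IsFlat nabla) (hs : nabla.ContMDiffCovariantDerivative ∞)
    (hq : IsConicalSpecialAffineCoords ε J g nabla ξ q)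
    (hq' : IsConicalSpecialAffineCoords ε J g nabla ξ q') {W : Set M}
    (hW : IsPreconnected W) (hWq : W ⊆ q.source ∩ q'.source) :
    ∃ A ∈ Matrix.symplecticGroup (Fin n) ℝ, ∀ x ∈ W, q' x = A.mulVec (q x) := by
  rcases W.eq_empty_or_nonempty with rfl | ⟨p, hp⟩
  -- A preconnected set may be empty.
  · exact ⟨1, one_mem _, fun x hx ↦ hx.elim⟩
  have hqs := hq.1.1.1
  have hqs' := hq'.1.1.1
  have hconst : ∀ x ∈ W, ∀ b, mvfderiv (𝓡 (2 * n)) q' x (coordField q b x) =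
      mvfderiv (𝓡 (2 * n)) q' p (coordField q b p) := fun x hx b ↦
    eq_of_eventually_eq (f := fun x ↦ mvfderiv (𝓡 (2 * n)) q' x (coordField q b x)) hW
      (fun x hx ↦ hq.1.1.eventually_mvfderiv_coordField_eq hflat hs hq'.1.1 (hWq hx).1 (hWq hx).2 b)
      hx hp
  let A : Matrix (Fin n ⊕ Fin n) (Fin n ⊕ Fin n) ℝ :=
    Matrix.of fun a b ↦ mvfderiv (𝓡 (2 * n)) q' p (coordField q b p) a
  have hA : ∀ x ∈ W, ∀ v, mvfderiv (𝓡 (2 * n)) q' x v =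
      A.mulVec (mvfderiv (𝓡 (2 * n)) q x v) := fun x hx v ↦ by
    conv_lhs => rw [(hqs.eq_sum_coordField_iff (hWq hx).1 (v := v)).2 rfl]
    simp only [map_sum, map_smul, hconst x hx]
    funext a
    simp [A, Matrix.mulVec, dotProduct, mul_comm]
  refine ⟨A, (mem_symplecticGroup_iff_stdSymp A).2 fun a b ↦ ?_, fun x hx ↦ ?_⟩
  -- Both systems express the same `ω` by the standard form, so `A` preserves that form.
  · obtain ⟨v, rfl⟩ := (hqs.bijective (hWq hp).1).2 a
    obtain ⟨w, rfl⟩ := (hqs.bijective (hWq hp).1).2 b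
    have h1 := hq.1.kahlerForm_eq hε (hWq hp).1 v w
    rw [hq'.1.kahlerForm_eq hε (hWq hp).2 v w, hA p hp, hA p hp] at h1
    linarith
  -- Conicality says `dq(ξ) = q` and `dq'(ξ) = q'`, so applying `dq' = A dq` to `ξ` gives the claim
  -- with no additive constant.
  · rw [← (hqs.eq_sum_coordField_iff (hWq hx).1).1 (hq.2 x (hWq hx).1), ← hA x hx]
    exact ((hqs'.eq_sum_coordField_iff (hWq hx).2).1 (hq'.2 x (hWq hx).2)).symm

end SpecialCoordinates
end
end SpecialGeometry

/-! ### Invariance under linear symplectic transformations. -/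

namespace SpecialGeometry

open Metric Filter Bundle
open scoped Topology

noncomputable section

section RealLinearAction

variable {n : ℕ} {ε : ℝ} {A : Matrix (Fin n ⊕ Fin n) (Fin n ⊕ Fin n) ℝ}

/-- The action of real `2n × 2n` matrices on `V = ℂ_ε^{2n}`. -/
def epsMulVec (A : Matrix (Fin n ⊕ Fin n) (Fin n ⊕ Fin n) ℝ) (a : EpsV ε n) : EpsV ε n :=
  fun j ↦ ⟨A.mulVec (fun b ↦ (a b).re) j, A.mulVec (fun b ↦ (a b).im) j⟩

theorem stdOmega_epsMulVec (hA : A ∈ Matrix.symplecticGroup (Fin n) ℝ) (a b : EpsV ε n) :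
    stdOmega (epsMulVec A a) (epsMulVec A b) = stdOmega a b := by
  rw [mem_symplecticGroup_iff_stdSymp] at hA
  ext
  · rw [stdOmega_re, stdOmega_re]
    simp only [epsMulVec]
    rw [hA, hA]
  · rw [stdOmega_im, stdOmega_im]
    simp only [epsMulVec]
    rw [hA, hA]

theorem epsMulVec_star (a : EpsV ε n) : epsMulVec A (star a) = star (epsMulVec A a) := by
  funext j
  have h : (fun b ↦ ((star a) b).im) = -fun b ↦ (a b).im := by ext b; simp
  ext
  · simp [epsMulVec]
  · simp only [epsMulVec, h, Matrix.mulVec_neg]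
    simp
    rfl

/-- A real matrix commutes with conjugation, so invariance of `Ω` passes to `γ`. -/
theorem stdGamma_epsMulVec (hA : A ∈ Matrix.symplecticGroup (Fin n) ℝ) (a b : EpsV ε n) :
    stdGamma (epsMulVec A a) (epsMulVec A b) = stdGamma a b := by
  rw [stdGamma, ← epsMulVec_star, stdOmega_epsMulVec hA, stdGamma]

theorem epsMulVec_epsI_mul (a : EpsV ε n) :
    epsMulVec A (fun j ↦ epsI ε * a j) = fun j ↦ epsI ε * epsMulVec A a j := by
  have hre : (fun b ↦ (epsI ε * a b).re) = ε • fun b ↦ (a b).im := by ext b; simp [epsI]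
  have him : (fun b ↦ (epsI ε * a b).im) = fun b ↦ (a b).re := by ext b; simp [epsI]
  funext j
  simp only [epsMulVec, hre, him, Matrix.mulVec_smul]
  ext <;> simp [epsI]

theorem epsMulVec_injective (hA : IsUnit A) :
    Function.Injective (epsMulVec (ε := ε) A) := fun a b hab ↦ by
  have h := Matrix.mulVec_injective_of_isUnit hA
  have hre := h (funext fun j ↦ congrArg (fun z ↦ (z j).re) hab)
  have him := h (funext fun j ↦ congrArg (fun z ↦ (z j).im) hab)
  funext j
  ext
  · exact congrFun hre j
  · exact congrFun him j

end RealLinearAction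

section Change

variable {n : ℕ} {M : Type*} [TopologicalSpace M]
  [ChartedSpace (EuclideanSpace ℝ (Fin (2 * n))) M] [IsManifold (𝓡 (2 * n)) ∞ M] {x : M}
  {ε : ℝ} {J : EndField n M} {g : BilinField n M} {ξ : VField n M} {U : Set M}
  {q : OpenPartialHomeomorph M (Fin n ⊕ Fin n → ℝ)} {φ : M → EpsV ε n}
  {nabla : Connection n M} {A : Matrix (Fin n ⊕ Fin n) (Fin n ⊕ Fin n) ℝ}

omit [IsManifold (𝓡 (2 * n)) ∞ M] in
theorem IsKahlerianLagrangianImmersionOn.epsDeriv_epsMulVec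
    (hφ : IsKahlerianLagrangianImmersionOn J φ U) (hU : IsOpen U) (hx : x ∈ U)
    (v : TangentSpace (𝓡 (2 * n)) x) :
    epsDeriv (fun y ↦ epsMulVec A (φ y)) x v = epsMulVec A (epsDeriv φ x v) := by
  have hr := hφ.mdifferentiableAt_re hU hx
  have hs := hφ.mdifferentiableAt_im hU hx
  have h1 := mvfderiv_clm_comp A.mulVecLin.toContinuousLinearMap hr v
  have h2 := mvfderiv_clm_comp A.mulVecLin.toContinuousLinearMap hs v
  rw [epsDeriv_eq (Eventually.of_forall fun y a ↦ rfl) (Eventually.of_forall fun y a ↦ rfl)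
      (mdifferentiableAt_clm_comp A.mulVecLin.toContinuousLinearMap hr)
      (mdifferentiableAt_clm_comp A.mulVecLin.toContinuousLinearMap hs),
    epsDeriv_eq (Eventually.of_forall fun y a ↦ rfl) (Eventually.of_forall fun y a ↦ rfl) hr hs]
  exact congrArg₂ (fun r s : Fin n ⊕ Fin n → ℝ ↦ (fun a ↦ ⟨r a, s a⟩ : EpsV ε n)) h1 h2

omit [IsManifold (𝓡 (2 * n)) ∞ M] in
theorem IsKahlerianLagrangianImmersionOn.epsMulVec
    (hφ : IsKahlerianLagrangianImmersionOn J φ U) (hU : IsOpen U)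
    (hA : A ∈ Matrix.symplecticGroup (Fin n) ℝ) :
    IsKahlerianLagrangianImmersionOn J (fun y ↦ epsMulVec A (φ y)) U := by
  have hAu : IsUnit A := (Matrix.isUnit_iff_isUnit_det A).2 (SymplecticGroup.symplectic_det hA)
  have hd : ∀ x ∈ U, ∀ v, epsDeriv (fun y ↦ SpecialGeometry.epsMulVec A (φ y)) x v =
      SpecialGeometry.epsMulVec A (epsDeriv φ x v) := fun x hx v ↦ hφ.epsDeriv_epsMulVec hU hx v
  refine ⟨fun a ↦ ?_, fun a ↦ ?_, fun x hx v w hvw ↦ ?_, fun x hx v ↦ ?_, fun x hx v hv ↦ ?_,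
    fun x hx v w ↦ ?_⟩
  · exact ((ContinuousLinearMap.proj a).comp
      A.mulVecLin.toContinuousLinearMap).contDiff.contMDiff.comp_contMDiffOn
      (contMDiffOn_pi_space.2 hφ.smooth_re)
  · exact ((ContinuousLinearMap.proj a).comp
      A.mulVecLin.toContinuousLinearMap).contDiff.contMDiff.comp_contMDiffOn
      (contMDiffOn_pi_space.2 hφ.smooth_im)
  · rw [hd x hx, hd x hx] at hvw
    exact hφ.immersion x hx (epsMulVec_injective hAu hvw)
  · rw [hd x hx, hd x hx, hφ.holomorphic x hx, epsMulVec_epsI_mul]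
  · refine hφ.kahlerian x hx v fun w ↦ ?_
    rw [← stdGamma_epsMulVec hA, ← hd x hx, ← hd x hx, hv]
  · rw [hd x hx, hd x hx, stdOmega_epsMulVec hA, hφ.lagrangian x hx]

/-- The immersion for `Aq` is `Aφ`. The coordinate fields of `Aq` are combinations of those of `q`
with the constant coefficients of `A⁻¹`, hence still parallel. -/
theorem IsConicalSpecialAffineCoords.exists_mulVec
    (hq : IsConicalSpecialAffineCoords ε J g nabla ξ q)
    (hA : A ∈ Matrix.symplecticGroup (Fin n) ℝ) :
    ∃ q' : OpenPartialHomeomorph M (Fin n ⊕ Fin n → ℝ), q'.source = q.source ∧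
      IsConicalSpecialAffineCoords ε J g nabla ξ q' ∧
      ∀ x ∈ q.source, q' x = A.mulVec (q x) := by
  have hdet := SymplecticGroup.symplectic_det hA
  let L : (Fin n ⊕ Fin n → ℝ) ≃L[ℝ] (Fin n ⊕ Fin n → ℝ) :=
    (Matrix.toLin'OfInv (A.nonsing_inv_mul hdet)
      (A.mul_nonsing_inv hdet)).toContinuousLinearEquiv
  have hL : ∀ w, L w = A.mulVec w := fun w ↦ Matrix.toLin'_apply A w
  let q' := q.transHomeomorph L.toHomeomorph
  have hsrc : q'.source = q.source := rfl
  have hqs := hq.1.1.1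
  have hqs' : IsSmoothCoords q' := by
    refine ⟨L.contDiff.contMDiff.comp_contMDiffOn hqs.1, ?_⟩
    exact hqs.2.comp L.symm.contDiff.contMDiff.contMDiffOn fun y hy ↦ hy
  have hdq : ∀ x ∈ q.source, ∀ v, mvfderiv (𝓡 (2 * n)) q' x v = L (mvfderiv (𝓡 (2 * n)) q x v) :=
    fun x hx v ↦ mvfderiv_clm_comp (L : (Fin n ⊕ Fin n → ℝ) →L[ℝ] (Fin n ⊕ Fin n → ℝ))
      (hqs.mdifferentiableAt hx) v
  have hcf : ∀ x ∈ q.source, ∀ a, coordField q' a x =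
      (∑ b, L.symm (Pi.single a 1) b • coordField q b : VField n M) x := fun x hx a ↦ by
    have h1 : (∑ b, L.symm (Pi.single a 1) b • coordField q b : VField n M) x =
        ∑ b, L.symm (Pi.single a 1) b • coordField q b x := by
      simp only [Finset.sum_apply, Pi.smul_apply]
    refine coordField_eq (hqs'.bijective hx) ?_
    rw [hdq x hx, (hqs.eq_sum_coordField_iff hx).1 h1, L.apply_symm_apply]
  obtain ⟨⟨⟨-, hpar⟩, φ, hφ, hg, hre⟩, hξ⟩ := hq
  refine ⟨q', hsrc, ⟨⟨⟨hqs', fun x hx a ↦ ?_⟩, fun y ↦ epsMulVec A (φ y),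
    hφ.epsMulVec q.open_source hA, fun x hx v w ↦ ?_, fun x hx a ↦ ?_⟩, fun x hx ↦ ?_⟩,
    fun x hx ↦ hL _⟩
  · have h := connection_sum_smul_eq_zero (fun b ↦ hqs.vFieldDiffAt_coordField hx b)
      (fun b ↦ hpar x hx b) (L.symm (Pi.single a 1)) Finset.univ
    rw [← h.2]
    refine connection_congr nabla h.1 ?_
    filter_upwards [q.open_source.mem_nhds hx] with y hy using hcf y hy a
  · rw [hφ.epsDeriv_epsMulVec q.open_source hx, hφ.epsDeriv_epsMulVec q.open_source hx,
      stdGamma_epsMulVec hA, hg x hx]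
  · refine (congrFun (hL (q x)) a).trans ?_
    rw [show q x = fun b ↦ (φ x b).re from funext (hre x hx)]
    rfl
  · refine (hqs'.eq_sum_coordField_iff hx).2 ?_
    rw [hdq x hx, (hqs.eq_sum_coordField_iff hx).1 (hξ x hx)]
    rfl

end Change
end
end SpecialGeometry

theorem mainTheorem3 (ε : ℝ) (hε : ε = -1 ∨ ε = 1) (n : ℕ)
    {M : Type*} [TopologicalSpace M] [T2Space M] [SecondCountableTopology M]
    [ChartedSpace (EuclideanSpace ℝ (Fin (2 * n))) M] [IsManifold (𝓡 (2 * n)) ∞ M]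
    (J : SpecialGeometry.EndField n M) (g : SpecialGeometry.BilinField n M)
    (nabla : SpecialGeometry.Connection n M) (ξ : SpecialGeometry.VField n M)
    (hM : SpecialGeometry.IsConicalAffineSpecialEpsKahler ε J g nabla ξ) :
    -- existence near any point
    (∀ p : M, ∃ q : OpenPartialHomeomorph M (Fin n ⊕ Fin n → ℝ),
      p ∈ q.source ∧ IsConnected q.source ∧
        SpecialGeometry.IsConicalSpecialAffineCoords ε J g nabla ξ q) ∧
    -- two systems differ by a linear symplectic transformation
    (∀ q q' : OpenPartialHomeomorph M (Fin n ⊕ Fin n → ℝ),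
      SpecialGeometry.IsConicalSpecialAffineCoords ε J g nabla ξ q →
      SpecialGeometry.IsConicalSpecialAffineCoords ε J g nabla ξ q' →
      ∀ W : Set M, IsOpen W → IsPreconnected W → W ⊆ q.source ∩ q'.source →
        ∃ A ∈ Matrix.symplecticGroup (Fin n) ℝ, ∀ x ∈ W, q' x = A.mulVec (q x)) ∧
    -- every linear symplectic transformation of such a system is such a system
    (∀ q : OpenPartialHomeomorph M (Fin n ⊕ Fin n → ℝ),
      SpecialGeometry.IsConicalSpecialAffineCoords ε J g nabla ξ q →
      ∀ A ∈ Matrix.symplecticGroup (Fin n) ℝ,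
        ∃ q' : OpenPartialHomeomorph M (Fin n ⊕ Fin n → ℝ), q'.source = q.source ∧
          SpecialGeometry.IsConicalSpecialAffineCoords ε J g nabla ξ q' ∧
          ∀ x ∈ q.source, q' x = A.mulVec (q x)) := by
  refine ⟨hM.exists_coords hε, fun q q' hq hq' W _ hW hWq ↦ ?_, fun q hq A hA ↦ hq.exists_mulVec hA⟩
  exact hq.exists_symplectic hε hM.affineSpecial.flat hM.affineSpecial.smooth hq' hW hWq
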